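/- A function $q\colon\mathbb{N}\to[0,1]$ is called \emph{smooth} if $q(n+1)=q(n)+o\big(\tfrac{1}{q(n)^2n^3}\big)$ as $n\to\infty$. Let $G(n,p)$ denote the binomial random graph on $n$ labelled vertices, in which each pair of vertices is an edge independently with probability $p$, and let $\chi$ denote the chromatic number. For functions of $n$ that are positive for all large $n$, write $f\ll g$ if $f(n)/g(n)\to0$ as $n\to\infty$. \textbf{Theorem.} There exist absolute constants $\varepsilon>0$ and $c>0$ such that the following holds. Let $q\colon\mathbb{N}\to[0,1]$ be a smooth function with $n^{-1}\log n\ll q(n)\ll n^{-2/3}$, and set $p(n)=1-q(n)$. Then there are infinitely many $n\in\mathbb{N}$ such that $$\mathbb{P}\big(\chi(G(n,p(n)))\in I\big)\le 1-\varepsilon$$ for every interval $I\subset\mathbb{R}$ of length $|I|\le c\,n^{3/2}q(n)^{3/2}$. -/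

import Mathlib

open Filter Asymptotics MeasureTheory
open scoped unitInterval SimpleGraph

/-- A function `q : ℕ → [0,1]` is *smooth* if `q (n + 1) = q n + o (1 / (q n ^ 2 * n ^ 3))`
as `n → ∞`. -/
def SmoothDensity (q : ℕ → I) : Prop :=
  (fun n : ℕ => (q (n + 1) : ℝ) - (q n : ℝ)) =o[atTop]
    (fun n : ℕ => 1 / ((q n : ℝ) ^ 2 * (n : ℝ) ^ 3))

/-- The probability that the chromatic number of the binomial random graph `G(n, p)` on the
vertex set `Fin n` lies in `A ⊆ ℝ`. (The chromatic number of a finite graph is finite, so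
`ENat.toNat` only changes its type.) -/
noncomputable def chromaticProb (n : ℕ) (p : I) (A : Set ℝ) : ℝ :=
  (SimpleGraph.binomialRandom (Fin n) p).real
    {G : SimpleGraph (Fin n) | ((G.chromaticNumber.toNat : ℕ) : ℝ) ∈ A}

/-! Let S be the random set of non-edges, so that colour classes are cliques of the sparse graph
`graph S`, which has edge density q. Write ν for its triangle packing number and X for its number of
triangles, with mean l = C(n,3)q³, of order (nq)³. The proof shows that 2χ equals n - ν up to
rounding, and that ν does not concentrate on an interval much shorter than √l.

With high probability there is no K₄, so classes have size at most 3 and n ≤ 2χ + ν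
(`card_le_two_mul_chromaticNumber_add`). Conversely, what a maximum triangle packing leaves over
still expands, hence has a perfect matching up to one vertex by Tutte's theorem, and 2χ + ν ≤ n + 1
(`Typical.two_mul_chromaticNumber_add_le`). `prob_not_typical_le` shows by union bounds that the
required properties hold with high probability.

Anticoncentration of ν (`mul_prob_packingNumber_le`) comes from the covariance of X with a bounded
increasing function ψ of ν. Cauchy–Schwarz bounds it above by sup ψ times the standard deviation of
X, which is O(√l). By size-biasing, the covariance is also q³ times the sum, over triples t, of the
expected increase of ψ when the edges of t are added. A triple disjoint from a maximum packing
raises ν by 1, and since n²q³ is small most triples are of this kind. So the covariance is at least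
about l · P(ν in the window), and this probability is small when the window is short compared with
√l. -/

namespace RandomSubset

/-! ### Expectations over a q-random subset of a finite set. -/

section

open scoped Classical

variable {ι : Type*} [Fintype ι]

/-- The probability that a `q`-random subset of `ι` equals `S`. -/
noncomputable def weight (q : ℝ) (S : Finset ι) : ℝ := (∏ _i ∈ S, q) * ∏ _i ∈ Sᶜ, (1 - q)

/-- Expectation with respect to a `q`-random subset of `ι`. -/
noncomputable def expect (q : ℝ) (g : Finset ι → ℝ) : ℝ := ∑ S, weight q S * g S

/-- Probability with respect to a `q`-random subset of `ι`. -/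
noncomputable def prob (q : ℝ) (P : Finset ι → Prop) : ℝ :=
  expect q (fun S => if P S then 1 else 0)

lemma prob_eq (q : ℝ) (P : Finset ι → Prop) [DecidablePred P] :
    prob q P = expect q (fun S => if P S then 1 else 0) := by
  rw [prob]
  congr! 3

lemma weight_nonneg {q : ℝ} (h0 : 0 ≤ q) (h1 : q ≤ 1) (S : Finset ι) : 0 ≤ weight q S :=
  mul_nonneg (Finset.prod_nonneg fun _ _ => h0) (Finset.prod_nonneg fun _ _ => sub_nonneg.2 h1)

/-- Expanding the right-hand product chooses one summand per index, and the indices choosing the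
first form S. Total mass, containment and avoidance probabilities, and the exponential moment are
specializations of this identity. -/
lemma expect_prod (q : ℝ) (f g : ι → ℝ) :
    expect q (fun S => (∏ i ∈ S, f i) * ∏ i ∈ Sᶜ, g i) = ∏ i, (q * f i + (1 - q) * g i) := by
  rw [Finset.prod_add, Finset.powerset_univ, expect]
  refine Finset.sum_congr rfl fun S _ => ?_
  rw [weight, ← Finset.compl_eq_univ_sdiff, Finset.prod_mul_distrib, Finset.prod_mul_distrib]
  ring

lemma expect_one (q : ℝ) : expect (ι := ι) q (fun _ => 1) = 1 := by
  simpa using expect_prod (ι := ι) q (fun _ => 1) (fun _ => 1)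

lemma expect_mono {q : ℝ} (h0 : 0 ≤ q) (h1 : q ≤ 1) {f g : Finset ι → ℝ} (h : ∀ S, f S ≤ g S) :
    expect q f ≤ expect q g :=
  Finset.sum_le_sum fun S _ => mul_le_mul_of_nonneg_left (h S) (weight_nonneg h0 h1 S)

lemma expect_add (q : ℝ) (f g : Finset ι → ℝ) :
    expect q (fun S => f S + g S) = expect q f + expect q g := by
  simp [expect, mul_add, Finset.sum_add_distrib]

lemma expect_sub (q : ℝ) (f g : Finset ι → ℝ) :
    expect q (fun S => f S - g S) = expect q f - expect q g := by
  simp [expect, mul_sub, Finset.sum_sub_distrib]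

lemma expect_const_mul (q c : ℝ) (f : Finset ι → ℝ) :
    expect q (fun S => c * f S) = c * expect q f := by
  simp only [expect, Finset.mul_sum]
  exact Finset.sum_congr rfl fun _ _ => by ring

lemma expect_const (q c : ℝ) : expect (ι := ι) q (fun _ => c) = c := by
  simpa [expect_one] using expect_const_mul (ι := ι) q c (fun _ => 1)

lemma expect_sum {α : Type*} (q : ℝ) (s : Finset α) (f : α → Finset ι → ℝ) :
    expect q (fun S => ∑ a ∈ s, f a S) = ∑ a ∈ s, expect q (f a) := by
  simp only [expect, Finset.mul_sum]
  exact Finset.sum_comm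

lemma expect_nonneg {q : ℝ} (h0 : 0 ≤ q) (h1 : q ≤ 1) {f : Finset ι → ℝ} (h : ∀ S, 0 ≤ f S) :
    0 ≤ expect q f :=
  Finset.sum_nonneg fun S _ => mul_nonneg (weight_nonneg h0 h1 S) (h S)

/-- Cauchy–Schwarz inequality against the constant function. -/
lemma expect_abs_le_sqrt {q : ℝ} (h0 : 0 ≤ q) (h1 : q ≤ 1) (f : Finset ι → ℝ) :
    expect q (fun S => |f S|) ≤ √(expect q (fun S => f S ^ 2)) := by
  apply Real.le_sqrt_of_sq_le
  set a := expect q (fun S => |f S|)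
  -- The variance of |f| is nonnegative.
  have h : 0 ≤ expect q (fun S => (|f S| - a) ^ 2) :=
    expect_nonneg h0 h1 fun _ => sq_nonneg _
  have e : (fun S => (|f S| - a) ^ 2) = fun S => (f S ^ 2 - (2 * a) * |f S|) + a ^ 2 := by
    funext S
    rw [sub_sq, sq_abs]
    ring
  rw [e, expect_add, expect_sub, expect_const_mul, expect_const] at h
  change 0 ≤ _ - 2 * a * a + a ^ 2 at h
  linarith

lemma prob_mono {q : ℝ} (h0 : 0 ≤ q) (h1 : q ≤ 1) {P Q : Finset ι → Prop} (h : ∀ S, P S → Q S) :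
    prob q P ≤ prob q Q := by
  refine expect_mono h0 h1 fun S => ?_
  by_cases hP : P S
  · simp [hP, h S hP]
  · simp only [hP, if_false]
    split_ifs <;> norm_num

lemma prob_or_le {q : ℝ} (h0 : 0 ≤ q) (h1 : q ≤ 1) (P Q : Finset ι → Prop) :
    prob q (fun S => P S ∨ Q S) ≤ prob q P + prob q Q := by
  rw [prob, prob, prob, ← expect_add]
  refine expect_mono h0 h1 fun S => ?_
  by_cases hP : P S <;> by_cases hQ : Q S <;> simp [hP, hQ]

/-- The union bound. -/
lemma prob_exists_le {α : Type*} {q : ℝ} (h0 : 0 ≤ q) (h1 : q ≤ 1) (s : Finset α)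
    (P : α → Finset ι → Prop) :
    prob q (fun S => ∃ a ∈ s, P a S) ≤ ∑ a ∈ s, prob q (P a) := by
  simp only [prob]
  rw [← expect_sum]
  refine expect_mono h0 h1 fun S => ?_
  have hn : ∀ a ∈ s, (0 : ℝ) ≤ if P a S then 1 else 0 := fun a _ => by split_ifs <;> norm_num
  split_ifs with h
  · obtain ⟨a, ha, hP⟩ := h
    exact le_trans (by simp [hP]) (Finset.single_le_sum hn ha)
  · exact Finset.sum_nonneg hn

/-- Markov's inequality. -/
lemma prob_le_expect_div {q : ℝ} (h0 : 0 ≤ q) (h1 : q ≤ 1) {f : Finset ι → ℝ} (hf : ∀ S, 0 ≤ f S)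
    {c : ℝ} (hc : 0 < c) : prob q (fun S => c ≤ f S) ≤ expect q f / c := by
  rw [le_div_iff₀ hc, mul_comm, prob, ← expect_const_mul]
  refine expect_mono h0 h1 fun S => ?_
  split_ifs with h
  · simpa using h
  · simpa using hf S

/-- The probability that each element of a random set satisfies `P` and each other element
satisfies `Q`. -/
lemma prob_forall_and_forall (q : ℝ) (P Q : ι → Prop) :
    prob q (fun S => (∀ i ∈ S, P i) ∧ ∀ i ∉ S, Q i) =
      ∏ i, (q * (if P i then 1 else 0) + (1 - q) * if Q i then 1 else 0) := by
  rw [← expect_prod, prob]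
  congr 1
  funext S
  rw [Finset.prod_boole, Finset.prod_boole]
  simp only [Finset.mem_compl]
  split_ifs <;> first | (exfalso; tauto) | norm_num

/-- Conditioning a `q`-random set on containing `A` amounts to adding `A` to it. -/
lemma expect_subset [dec : DecidableEq ι] (q : ℝ) (A : Finset ι)
    (g : Finset ι → ℝ) :
    expect q (fun S => if A ⊆ S then g S else 0) = q ^ A.card * expect q (fun S => g (S ∪ A)) := by
  obtain rfl : dec = fun a b => Classical.propDecidable (a = b) := Subsingleton.elim _ _
  -- S ∪ A = S₀ fixes S outside A and leaves it free on A, so the fibre has the weight of S₀ with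
  -- its factors q over A removed.
  have key : ∀ S₀ : Finset ι, A ⊆ S₀ →
      weight q S₀ = q ^ A.card * ∑ S with S ∪ A = S₀, weight q S := by
    intro S₀ hA
    have h1 : ∑ S with S ∪ A = S₀, weight q S =
        prob q (fun S => (∀ i ∈ S, i ∈ S₀) ∧ ∀ i ∉ S, (i ∈ A ∨ i ∉ S₀)) := by
      rw [Finset.sum_filter, prob, expect]
      refine Finset.sum_congr rfl fun S _ => ?_
      have : S ∪ A = S₀ ↔ (∀ i ∈ S, i ∈ S₀) ∧ ∀ i ∉ S, (i ∈ A ∨ i ∉ S₀) := by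
        constructor
        · rintro rfl
          grind
        · rintro ⟨h1, h2⟩
          ext i
          have := @hA i
          grind
      simp [this]
    have h2 : q ^ A.card = ∏ i, if i ∈ A then q else 1 := by simp
    have h3 : weight q S₀ = ∏ i, if i ∈ S₀ then q else 1 - q := by
      simp [weight, Finset.prod_ite, Finset.filter_not, Finset.compl_eq_univ_sdiff]
    rw [h1, prob_forall_and_forall, h2, h3, ← Finset.prod_mul_distrib]
    refine Finset.prod_congr rfl fun i _ => ?_
    by_cases hi : i ∈ A
    · simp [hi, hA hi]
    · by_cases hi' : i ∈ S₀ <;> simp [hi, hi']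
  calc expect q (fun S => if A ⊆ S then g S else 0)
      = ∑ S₀, ∑ S with S ∪ A = S₀, q ^ A.card * (weight q S * g (S ∪ A)) := by
        refine Finset.sum_congr rfl fun S₀ _ => ?_
        dsimp only
        split_ifs with hA
        · rw [key S₀ hA, mul_assoc, Finset.sum_mul, Finset.mul_sum]
          refine Finset.sum_congr rfl fun S hS => ?_
          rw [(Finset.mem_filter.1 hS).2]
        · rw [mul_zero, Finset.sum_eq_zero]
          intro S hS
          exact absurd ((Finset.mem_filter.1 hS).2 ▸ Finset.subset_union_right) hA
    _ = _ := by
        rw [Finset.sum_fiberwise, expect, Finset.mul_sum]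

lemma prob_subset (q : ℝ) (A : Finset ι) : prob q (fun S => A ⊆ S) = q ^ A.card := by
  have h := expect_subset q A (fun _ => 1)
  rw [expect_one, mul_one] at h
  rw [← h, prob_eq]

lemma prob_disjoint (q : ℝ) (A : Finset ι) :
    prob q (fun S => Disjoint A S) = (1 - q) ^ A.card := by
  have h : ∀ S : Finset ι, Disjoint A S ↔ (∀ i ∈ S, i ∉ A) ∧ ∀ i ∉ S, True := by
    intro S
    rw [disjoint_comm, Finset.disjoint_left]
    simp
  simp only [h]
  rw [prob_forall_and_forall, ← Finset.prod_const, ← Finset.prod_subset (Finset.subset_univ A)]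
  · exact Finset.prod_congr rfl fun i hi => by simp [hi]
  · intro i _ hi
    simp [hi]

/-- An exponential Markov bound for the lower tail of the size of a random set inside `A`. -/
lemma prob_card_inter_lt_le [dec : DecidableEq ι] {q : ℝ} (h0 : 0 ≤ q) (h1 : q ≤ 1) (A : Finset ι) (k : ℕ) :
    prob q (fun S => (A ∩ S).card < k) ≤ 2 ^ k * (1 - q / 2) ^ A.card := by
  obtain rfl : dec = fun a b => Classical.propDecidable (a = b) := Subsingleton.elim _ _
  have h : expect q (fun S => (1 / 2 : ℝ) ^ (A ∩ S).card) = (1 - q / 2) ^ A.card := by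
    have := expect_prod q (fun i : ι => if i ∈ A then (1 / 2 : ℝ) else 1) (fun _ => 1)
    have e : ∀ S : Finset ι, (∏ i ∈ S, if i ∈ A then (1 / 2 : ℝ) else 1) =
        (1 / 2 : ℝ) ^ (A ∩ S).card := by
      intro S
      rw [Finset.prod_ite, Finset.prod_const, Finset.prod_const_one, mul_one,
        Finset.filter_mem_eq_inter, Finset.inter_comm]
    simp only [e, Finset.prod_const_one, mul_one] at this
    rw [this, ← Finset.prod_const, ← Finset.prod_subset (Finset.subset_univ A)]
    · refine Finset.prod_congr rfl fun i hi => ?_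
      simp only [hi, if_true]
      ring
    · intro i _ hi
      simp [hi]
  rw [← h, ← expect_const_mul]
  refine expect_mono h0 h1 fun S => ?_
  split_ifs with hS
  · rw [one_div, inv_pow, ← div_eq_mul_inv, le_div_iff₀ (by positivity), one_mul]
    exact pow_le_pow_right₀ (by norm_num) hS.le
  · positivity

end

end RandomSubset

/-! ### Perfect matchings in expanding graphs. -/

namespace SimpleGraph

section

open scoped Classical

/-- A quasirandom expansion criterion for perfect matchings, via Tutte's theorem. -/
lemma exists_isPerfectMatching_of_expansion {V : Type*} [Fintype V] (H : SimpleGraph V) (m D : ℕ)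
    (heven : Even (Fintype.card V)) (hcard : 8 * m ≤ Fintype.card V)
    (hdeg : ∀ v, D ≤ (Finset.univ.filter (H.Adj v)).card)
    (hjoin : ∀ A B : Finset V, Disjoint A B → A.card = m → B.card = m →
      ∃ a ∈ A, ∃ b ∈ B, H.Adj a b)
    (hsparse : ∀ Z : Finset V, Z.Nonempty → Z.card < 2 * m →
      2 * ∑ z ∈ Z, (Z.filter (H.Adj z)).card < Z.card * D) :
    ∃ M : H.Subgraph, M.IsPerfectMatching := by
  rw [SimpleGraph.tutte]
  intro u hu
  rw [IsTutteViolator] at hu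
  set G' := ((⊤ : H.Subgraph).deleteVerts u).coe with hG'
  have hadj : ∀ a b : ((⊤ : H.Subgraph).deleteVerts u).verts, G'.Adj a b ↔ H.Adj a b := by
    rintro ⟨a, ha⟩ ⟨b, hb⟩
    simp only [Subgraph.deleteVerts_verts, Subgraph.verts_top, Set.mem_sdiff, Set.mem_univ,
      true_and] at ha hb
    simp [hG', ha, hb]
  have hmem : ∀ v, v ∈ ((⊤ : H.Subgraph).deleteVerts u).verts ↔ v ∉ u := by simp
  set W : Finset V := Finset.univ.filter (· ∉ u) with hW
  have hWc : Nat.card ((⊤ : H.Subgraph).deleteVerts u).verts = W.card := by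
    rw [Nat.card_eq_fintype_card, Fintype.card_subtype]
    congr 1
    ext v
    simp [hW]
  have huc : u.ncard = (Finset.univ.filter (· ∈ u)).card := by
    rw [Set.ncard_eq_toFinset_card']
    congr 1
    ext v
    simp
  set U : Finset V := Finset.univ.filter (· ∈ u) with hU
  have hUW : U.card + W.card = Fintype.card V := by
    rw [hU, hW, Finset.card_filter_add_card_filter_not, Finset.card_univ]
  -- the vertex set of a component
  let vs : G'.ConnectedComponent → Finset V := fun c =>
    Finset.univ.filter fun v => ∃ x ∈ c.supp, (x : V) = v
  have hvsW : ∀ c, vs c ⊆ W := by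
    intro c v hv
    obtain ⟨x, _, rfl⟩ := (Finset.mem_filter.1 hv).2
    simpa [hW] using x.2
  have hvsclosed : ∀ c, ∀ a ∈ vs c, ∀ b ∈ W, H.Adj a b → b ∈ vs c := by
    intro c a ha b hb hab
    obtain ⟨x, hx, rfl⟩ := (Finset.mem_filter.1 ha).2
    have hb' : b ∈ ((⊤ : H.Subgraph).deleteVerts u).verts := (hmem b).2 (Finset.mem_filter.1 hb).2
    refine Finset.mem_filter.2 ⟨Finset.mem_univ _, ⟨b, hb'⟩, ?_, rfl⟩
    exact c.mem_supp_of_adj_mem_supp hx ((hadj x ⟨b, hb'⟩).2 hab)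
  have hvsdisj : ∀ c c', c ≠ c' → Disjoint (vs c) (vs c') := by
    intro c c' hne
    rw [Finset.disjoint_left]
    intro v hv hv'
    obtain ⟨x, hx, rfl⟩ := (Finset.mem_filter.1 hv).2
    obtain ⟨y, hy, hxy⟩ := (Finset.mem_filter.1 hv').2
    rw [Subtype.ext hxy] at hy
    exact hne (hx.symm.trans hy)
  have hcount : G'.oddComponents.ncard ≤ W.card := by
    rw [← hWc]
    refine (Set.ncard_le_card _).trans ?_
    exact Nat.card_le_card_of_surjective G'.connectedComponentMk Quot.mk_surjective
  -- Since |V| is even, the number of odd components has the parity of |U|, so exceeding |U| means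
  -- exceeding it by at least 2. Together with `hcR` below this gives |U| < |R|, in particular R is
  -- nonempty.
  have hpar : Odd G'.oddComponents.ncard ↔ Odd W.card := by
    rw [odd_ncard_oddComponents, hWc]
  have hcomp2 : U.card + 2 ≤ G'.oddComponents.ncard := by
    rw [huc] at hu
    rw [← hUW] at heven
    grind
  -- closed sets are small or cosmall
  let Closed : Finset V → Prop := fun A => A ⊆ W ∧ ∀ a ∈ A, ∀ b ∈ W, H.Adj a b → b ∈ A
  have hsmall : ∀ A, Closed A → A.card < m ∨ (W \ A).card < m := by
    intro A hA
    by_contra! h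
    obtain ⟨A', hA', hA'm⟩ := Finset.exists_subset_card_eq h.1
    obtain ⟨B', hB', hB'm⟩ := Finset.exists_subset_card_eq h.2
    obtain ⟨a, ha, b, hb, hab⟩ := hjoin A' B'
      (Finset.disjoint_of_subset_left hA' (Finset.disjoint_of_subset_right hB'
        Finset.disjoint_sdiff)) hA'm hB'm
    have := Finset.mem_sdiff.1 (hB' hb)
    exact this.2 (hA.2 a (hA' ha) b this.1 hab)
  have hm : 0 < m := by
    by_contra h0
    have := hjoin ∅ ∅ (by simp) (by simp; omega) (by simp; omega)
    simp at this
  obtain ⟨R, hR, hRmax⟩ := Finset.exists_max_image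
    (Finset.univ.filter fun A : Finset V => Closed A ∧ A.card < m) Finset.card
    ⟨∅, by simp [Closed, hm]⟩
  obtain ⟨hRc, hRm⟩ := (Finset.mem_filter.1 hR).2
  have hmaxR : ∀ A, Closed A → A.card < m → A ⊆ R := by
    intro A hA hAm
    have hcl : Closed (A ∪ R) := by
      refine ⟨Finset.union_subset hA.1 hRc.1, fun a ha b hb hab => ?_⟩
      rcases Finset.mem_union.1 ha with ha | ha
      · exact Finset.mem_union_left _ (hA.2 a ha b hb hab)
      · exact Finset.mem_union_right _ (hRc.2 a ha b hb hab)
    have hle := Finset.card_union_le A R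
    -- If A ∪ R were cosmall then |W| < 3m, whereas |U| + 2 ≤ |W| and 8m ≤ |V| force |W| > 4m. So
    -- small closed sets are stable under union and R contains them all.
    have hsm : (A ∪ R).card < m := by
      rcases hsmall _ hcl with h | h
      · exact h
      · rw [Finset.card_sdiff_of_subset hcl.1] at h
        omega
    have := hRmax (A ∪ R) (Finset.mem_filter.2 ⟨Finset.mem_univ _, hcl, hsm⟩)
    exact Finset.union_eq_right.1
      (Finset.eq_of_subset_of_card_le Finset.subset_union_right this).symm
  have hbig : ∀ c c', ¬ vs c ⊆ R → ¬ vs c' ⊆ R → c = c' := by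
    intro c c' hc hc'
    by_contra hne
    rcases hsmall (vs c) ⟨hvsW c, hvsclosed c⟩ with h | h
    · exact hc (hmaxR _ ⟨hvsW c, hvsclosed c⟩ h)
    · have : vs c' ⊆ W \ vs c :=
        Finset.subset_sdiff.2 ⟨hvsW c', (hvsdisj c c' hne).symm⟩
      exact hc' (hmaxR _ ⟨hvsW c', hvsclosed c'⟩ ((Finset.card_le_card this).trans_lt h))
  have hcR : G'.oddComponents.ncard ≤ R.card + 1 := by
    have h1 : G'.oddComponents ⊆ {c | vs c ⊆ R} ∪ {c | ¬ vs c ⊆ R} := by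
      intro c _
      exact em _
    refine (Set.ncard_le_ncard h1).trans ((Set.ncard_union_le _ _).trans (add_le_add ?_ ?_))
    -- Components inside R inject into R through a representative vertex; at most one component is
    -- not inside R.
    · rw [← Set.ncard_coe_finset]
      refine Set.ncard_le_ncard_of_injOn (fun c => (c.out : V)) ?_ ?_
      · intro c hc
        refine hc (Finset.mem_filter.2 ⟨Finset.mem_univ _, c.out, ?_, rfl⟩)
        exact Quot.out_eq c
      · intro c _ c' _ h
        have := Subtype.ext h
        rw [← Quot.out_eq c, ← Quot.out_eq c']
        exact congrArg _ this
    · rw [Set.ncard_le_one]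
      exact fun c hc c' hc' => hbig c c' hc hc'
  -- All edges from R stay in R ∪ U, so R ∪ U spans degree sum at least |R|·D. As |R ∪ U| ≤ 2|R|,
  -- this contradicts sparsity.
  have hZ := hsparse (R ∪ U) (Finset.card_pos.1 (by
    have := Finset.card_le_card (Finset.subset_union_left (s₁ := R) (s₂ := U)); omega))
    (by have := Finset.card_union_le R U; omega)
  have h1 : R.card * D ≤ ∑ z ∈ R ∪ U, ((R ∪ U).filter (H.Adj z)).card := by
    rw [← smul_eq_mul]
    refine (Finset.card_nsmul_le_sum R _ D fun z hz => (hdeg z).trans (Finset.card_le_card ?_)).trans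
      (Finset.sum_le_sum_of_subset Finset.subset_union_left)
    intro w hw
    have hzw := (Finset.mem_filter.1 hw).2
    refine Finset.mem_filter.2 ⟨?_, hzw⟩
    by_cases hwu : w ∈ u
    · exact Finset.mem_union_right _ (by simp [hU, hwu])
    · exact Finset.mem_union_left _ (hRc.2 z hz w (by simp [hW, hwu]) hzw)
  have h2 : (R ∪ U).card * D ≤ 2 * R.card * D := by
    refine Nat.mul_le_mul_right _ ?_
    have := Finset.card_union_le R U
    omega
  rw [mul_assoc] at h2
  omega

end

end SimpleGraph

/-! ### Cliques, triangle packings and colourings of the complement. -/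

namespace RandomSubset

section

open scoped Classical

variable {n : ℕ}

/-- The pairs of distinct vertices of `t`. -/
noncomputable def pairs (t : Finset (Fin n)) : Finset (Sym2 (Fin n)) :=
  t.offDiag.image (fun x => s(x.1, x.2))

lemma mk_mem_pairs {t : Finset (Fin n)} {u v : Fin n} :
    s(u, v) ∈ pairs t ↔ u ∈ t ∧ v ∈ t ∧ u ≠ v := by
  simp only [pairs, Finset.mem_image, Finset.mem_offDiag, Prod.exists, Sym2.eq_iff]
  grind

lemma card_pairs (t : Finset (Fin n)) : (pairs t).card = t.card.choose 2 :=
  Sym2.card_image_offDiag t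

lemma pairs_subset_iff {t : Finset (Fin n)} {S : Finset (Sym2 (Fin n))} :
    pairs t ⊆ S ↔ ∀ u ∈ t, ∀ v ∈ t, u ≠ v → s(u, v) ∈ S := by
  constructor
  · intro h u hu v hv huv
    exact h (mk_mem_pairs.2 ⟨hu, hv, huv⟩)
  · intro h e
    induction e with
    | _ u v =>
      intro he
      obtain ⟨hu, hv, huv⟩ := mk_mem_pairs.1 he
      exact h u hu v hv huv

lemma pairs_mono {s t : Finset (Fin n)} (h : s ⊆ t) : pairs s ⊆ pairs t :=
  pairs_subset_iff.2 fun _ hu _ hv huv => mk_mem_pairs.2 ⟨h hu, h hv, huv⟩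

/-- The graph whose edges are the off-diagonal elements of `S`. -/
def graph (S : Finset (Sym2 (Fin n))) : SimpleGraph (Fin n) :=
  SimpleGraph.fromEdgeSet (S : Set (Sym2 (Fin n)))

lemma graph_adj {S : Finset (Sym2 (Fin n))} {u v : Fin n} :
    (graph S).Adj u v ↔ s(u, v) ∈ S ∧ u ≠ v := by
  simp [graph]

/-- The triangles of `graph S`. -/
noncomputable def triangles (S : Finset (Sym2 (Fin n))) : Finset (Finset (Fin n)) :=
  (Finset.univ.powersetCard 3).filter fun t => pairs t ⊆ S

/-- The vertex-disjoint families of triangles of `graph S`. -/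
noncomputable def packings (S : Finset (Sym2 (Fin n))) : Finset (Finset (Finset (Fin n))) :=
  (triangles S).powerset.filter fun M => (M : Set (Finset (Fin n))).PairwiseDisjoint id

/-- The largest number of vertex-disjoint triangles of `graph S`. -/
noncomputable def packingNumber (S : Finset (Sym2 (Fin n))) : ℕ :=
  (packings S).sup Finset.card

lemma mem_triangles {S : Finset (Sym2 (Fin n))} {t : Finset (Fin n)} :
    t ∈ triangles S ↔ t.card = 3 ∧ pairs t ⊆ S := by
  simp [triangles]

lemma mem_packings {S : Finset (Sym2 (Fin n))} {M : Finset (Finset (Fin n))} :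
    M ∈ packings S ↔ M ⊆ triangles S ∧ (M : Set (Finset (Fin n))).PairwiseDisjoint id := by
  simp [packings]

lemma exists_mem_packings_card_eq (S : Finset (Sym2 (Fin n))) :
    ∃ M ∈ packings S, M.card = packingNumber S := by
  obtain ⟨M, hM, h⟩ := Finset.exists_mem_eq_sup (packings S) ⟨∅, by simp [mem_packings]⟩
    Finset.card
  exact ⟨M, hM, h.symm⟩

lemma card_le_packingNumber {S : Finset (Sym2 (Fin n))} {M : Finset (Finset (Fin n))}
    (hM : M ∈ packings S) : M.card ≤ packingNumber S :=
  Finset.le_sup (f := Finset.card) hM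

lemma packingNumber_le_card_triangles (S : Finset (Sym2 (Fin n))) :
    packingNumber S ≤ (triangles S).card := by
  obtain ⟨M, hM, h⟩ := exists_mem_packings_card_eq S
  exact h ▸ Finset.card_le_card (mem_packings.1 hM).1

lemma card_biUnion_packing {S : Finset (Sym2 (Fin n))} {M : Finset (Finset (Fin n))}
    (hM : M ∈ packings S) : (M.biUnion id).card = 3 * M.card := by
  rw [mem_packings] at hM
  rw [Finset.card_biUnion hM.2, Finset.sum_const_nat (m := 3), mul_comm]
  exact fun t ht => (mem_triangles.1 (hM.1 ht)).1

/-- Colour each vertex by a chosen clique of the cover that contains it; the cliques may overlap. -/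
lemma colorable_compl_of_cover (S : Finset (Sym2 (Fin n))) (P : Finset (Finset (Fin n)))
    (hP : ∀ t ∈ P, pairs t ⊆ S) (hcov : ∀ v, ∃ t ∈ P, v ∈ t) :
    ((graph S)ᶜ).Colorable P.card := by
  choose f hf hv using hcov
  have C : ((graph S)ᶜ).Coloring P := by
    refine SimpleGraph.Coloring.mk (fun v => ⟨f v, hf v⟩) ?_
    intro u v huv heq
    have heq' : f u = f v := congrArg Subtype.val heq
    rw [SimpleGraph.compl_adj, graph_adj] at huv
    exact huv.2 ⟨pairs_subset_iff.1 (hP _ (hf u)) u (hv u) v (heq' ▸ hv v) huv.1, huv.1⟩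
  simpa using C.colorable

/-- Without cliques of size four, a colouring of the complement consists of triangles, edges and
single vertices. -/
lemma card_le_two_mul_chromaticNumber_add (S : Finset (Sym2 (Fin n)))
    (h4 : ∀ t : Finset (Fin n), t.card = 4 → ¬ pairs t ⊆ S) :
    n ≤ 2 * ((graph S)ᶜ).chromaticNumber.toNat + packingNumber S := by
  set k := ((graph S)ᶜ).chromaticNumber.toNat
  have hcol : ((graph S)ᶜ).Colorable k :=
    SimpleGraph.colorable_chromaticNumber_of_fintype _
  obtain ⟨C⟩ := hcol
  let cls : Fin k → Finset (Fin n) := fun c => Finset.univ.filter fun v => C v = c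
  have hcls : ∀ c, pairs (cls c) ⊆ S := by
    intro c
    refine pairs_subset_iff.2 fun u hu v hv huv => ?_
    by_contra hS
    have : ((graph S)ᶜ).Adj u v := by
      rw [SimpleGraph.compl_adj, graph_adj]
      exact ⟨huv, fun h => hS h.1⟩
    exact C.valid this ((Finset.mem_filter.1 hu).2.trans (Finset.mem_filter.1 hv).2.symm)
  have hle : ∀ c, (cls c).card ≤ 3 := by
    intro c
    by_contra! h
    obtain ⟨t, ht, htc⟩ := Finset.exists_subset_card_eq h
    exact h4 t htc ((pairs_mono ht).trans (hcls c))
  have hdisj : ∀ c c', c ≠ c' → Disjoint (cls c) (cls c') := by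
    intro c c' hne
    rw [Finset.disjoint_left]
    intro v hv hv'
    exact hne ((Finset.mem_filter.1 hv).2.symm.trans (Finset.mem_filter.1 hv').2)
  set F := Finset.univ.filter fun c => (cls c).card = 3 with hF
  have hpack : F.image cls ∈ packings S := by
    rw [mem_packings]
    constructor
    · intro t ht
      obtain ⟨c, hc, rfl⟩ := Finset.mem_image.1 ht
      exact mem_triangles.2 ⟨(Finset.mem_filter.1 hc).2, hcls c⟩
    · intro t ht t' ht' hne
      obtain ⟨c, hc, rfl⟩ := Finset.mem_image.1 (Finset.mem_coe.1 ht)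
      obtain ⟨c', hc', rfl⟩ := Finset.mem_image.1 (Finset.mem_coe.1 ht')
      exact hdisj c c' fun h => hne (h ▸ rfl)
  have hFcard : (F.image cls).card = F.card := by
    refine Finset.card_image_of_injOn fun c hc c' _ h => ?_
    by_contra hne
    have := hdisj c c' hne
    rw [← h, disjoint_self] at this
    have h3 := (Finset.mem_filter.1 hc).2
    rw [this] at h3
    simp at h3
  have hsum : n = ∑ c, (cls c).card := by
    have := Finset.card_eq_sum_card_fiberwise (s := (Finset.univ : Finset (Fin n)))
      (t := Finset.univ) (f := C) (fun _ _ => Finset.mem_coe.2 (Finset.mem_univ _))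
    simpa using this
  -- Each class accounts for at most two vertices, plus one more if it is a triangle; the triangle
  -- classes form a packing.
  have hsum' : ∑ c, (cls c).card ≤ ∑ c : Fin k, (2 + if (cls c).card = 3 then 1 else 0) := by
    refine Finset.sum_le_sum fun c _ => ?_
    have := hle c
    split_ifs <;> omega
  rw [Finset.sum_add_distrib, ← Finset.card_filter] at hsum'
  have := card_le_packingNumber hpack
  rw [hFcard] at this
  simp only [Finset.sum_const, Finset.card_univ, Fintype.card_fin, smul_eq_mul] at hsum'
  rw [← hF] at hsum'
  omega

/-- Handshake: each edge inside Z is counted once from each end. -/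
lemma sum_card_filter_adj_le (S : Finset (Sym2 (Fin n))) (Z : Finset (Fin n)) :
    ∑ z ∈ Z, (Z.filter ((graph S).Adj z)).card ≤ 2 * (pairs Z ∩ S).card := by
  rw [← Finset.card_sigma]
  refine Finset.card_le_mul_card_image_of_maps_to (f := fun x => s(x.1, x.2)) ?_ 2 ?_
  · rintro ⟨z, w⟩ h
    simp only [Finset.mem_sigma, Finset.mem_filter, graph_adj] at h
    exact Finset.mem_inter.2 ⟨mk_mem_pairs.2 ⟨h.1, h.2.1, h.2.2.2⟩, h.2.2.1⟩
  · intro e _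
    induction e with
    | _ u v =>
      refine (Finset.card_le_card (t := {⟨u, v⟩, ⟨v, u⟩}) ?_).trans Finset.card_le_two
      rintro ⟨z, w⟩ h
      have := (Finset.mem_filter.1 h).2
      simp only [Sym2.eq_iff] at this
      rcases this with ⟨rfl, rfl⟩ | ⟨rfl, rfl⟩ <;> simp

/-! ### Typical graphs and their chromatic number. -/

/-- The properties of a sparse random graph that determine the chromatic number of its complement
from its triangle packing number. -/
structure Typical (D y m : ℕ) (S : Finset (Sym2 (Fin n))) : Prop where
  no_four : ∀ t : Finset (Fin n), t.card = 4 → ¬ pairs t ⊆ S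
  few_triangles : 16 * (triangles S).card < n
  degree : ∀ v, D + 3 * y + 1 ≤ (Finset.univ.filter ((graph S).Adj v)).card
  packing_degree : ∀ v, ∀ M ∈ packings S, v ∉ M.biUnion id →
    (M.filter fun t => ∃ u ∈ t, s(v, u) ∈ S).card < y
  joined : ∀ A B : Finset (Fin n), Disjoint A B → A.card = m → B.card = m →
    ∃ a ∈ A, ∃ b ∈ B, s(a, b) ∈ S
  sparse : ∀ Z : Finset (Fin n), Z.Nonempty → Z.card < 2 * m →
    4 * (pairs Z ∩ S).card < Z.card * D

/-- Joinedness and sparsity pass to induced subgraphs. Only the minimum degree could suffer from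
deleting the packing, and `packing_degree` limits that loss. -/
lemma Typical.exists_isPerfectMatching {D y m : ℕ} {S : Finset (Sym2 (Fin n))}
    (hS : Typical D y m S) (hm : 16 * m ≤ n) {M : Finset (Finset (Fin n))} (hM : M ∈ packings S)
    {W : Finset (Fin n)} (hW : W ⊆ (M.biUnion id)ᶜ) (hWc : ((M.biUnion id)ᶜ).card ≤ W.card + 1)
    (heven : Even W.card) :
    ∃ N : ((graph S).comap ((↑) : W → Fin n)).Subgraph, N.IsPerfectMatching := by
  have hMt : 16 * M.card < n :=
    lt_of_le_of_lt (Nat.mul_le_mul_left _ (Finset.card_le_card (mem_packings.1 hM).1))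
      hS.few_triangles
  have hbi := card_biUnion_packing hM
  obtain ⟨H, hH⟩ : ∃ H, H = (graph S).comap ((↑) : W → Fin n) := ⟨_, rfl⟩
  have hadj : ∀ a b, H.Adj a b ↔ (graph S).Adj a b := fun a b => by rw [hH, SimpleGraph.comap_adj]
  rw [← hH]
  refine SimpleGraph.exists_isPerfectMatching_of_expansion H m D (by simpa using heven) ?_ ?_ ?_ ?_
  · rw [Finset.card_compl, Fintype.card_fin] at hWc
    rw [Fintype.card_coe]
    omega
  · rintro ⟨v, hv⟩
    have hvM : v ∉ M.biUnion id := Finset.mem_compl.1 (hW hv)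
    have h1 := hS.degree v
    have h2 := hS.packing_degree v M hM hvM
    -- A neighbour of v outside W lies in one of fewer than y packing triangles touched by v, or is
    -- the one leftover vertex. This is the 3y + 1 in the field `degree`.
    have h3 : (Finset.univ.filter ((graph S).Adj v)) ⊆
        (Finset.univ.filter (H.Adj ⟨v, hv⟩)).map
          (Function.Embedding.subtype _) ∪
        (((M.filter fun t => ∃ u ∈ t, s(v, u) ∈ S).biUnion id) ∪ ((M.biUnion id)ᶜ \ W)) := by
      intro w hw
      have hvw := (Finset.mem_filter.1 hw).2
      by_cases hwW : w ∈ W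
      · exact Finset.mem_union_left _ (Finset.mem_map.2 ⟨⟨w, hwW⟩, by simpa [hadj] using hvw, rfl⟩)
      · refine Finset.mem_union_right _ ?_
        by_cases hwM : w ∈ M.biUnion id
        · refine Finset.mem_union_left _ ?_
          obtain ⟨t, ht, hwt⟩ := Finset.mem_biUnion.1 hwM
          exact Finset.mem_biUnion.2
            ⟨t, Finset.mem_filter.2 ⟨ht, w, hwt, (graph_adj.1 hvw).1⟩, hwt⟩
        · exact Finset.mem_union_right _
            (Finset.mem_sdiff.2 ⟨Finset.mem_compl.2 hwM, hwW⟩)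
    have h4 := (Finset.card_le_card h3).trans ((Finset.card_union_le _ _).trans
      (add_le_add le_rfl (Finset.card_union_le _ _)))
    have h5 := Finset.card_biUnion_le_card_mul (M.filter fun t => ∃ u ∈ t, s(v, u) ∈ S) id 3
      fun t ht => (mem_triangles.1 ((mem_packings.1 hM).1 (Finset.mem_filter.1 ht).1)).1.le
    rw [Finset.card_map, Finset.card_sdiff_of_subset hW] at h4
    omega
  · intro A B hAB hA hB
    obtain ⟨a, ha, b, hb, hab⟩ := hS.joined (A.map (Function.Embedding.subtype _))
      (B.map (Function.Embedding.subtype _)) ((Finset.disjoint_map _).2 hAB) (by simpa using hA)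
      (by simpa using hB)
    obtain ⟨a, ha', rfl⟩ := Finset.mem_map.1 ha
    obtain ⟨b, hb', rfl⟩ := Finset.mem_map.1 hb
    refine ⟨a, ha', b, hb', ?_⟩
    rw [hadj, graph_adj]
    refine ⟨hab, fun h => ?_⟩
    exact Finset.disjoint_left.1 hAB ha' ((Subtype.ext h : a = b) ▸ hb')
  · intro Z hZ hZm
    have h1 := hS.sparse (Z.map (Function.Embedding.subtype _)) (by simpa using hZ)
      (by simpa using hZm)
    have h2 := sum_card_filter_adj_le S (Z.map (Function.Embedding.subtype _))
    rw [Finset.sum_map] at h2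
    rw [Finset.card_map] at h1
    have h3 : ∀ z : W, ((Z.map (Function.Embedding.subtype _)).filter
        ((graph S).Adj (Function.Embedding.subtype _ z))).card =
        (Z.filter (H.Adj z)).card := by
      intro z
      rw [Finset.filter_map, Finset.card_map]
      congr 1
      ext w
      rw [Finset.mem_filter, Finset.mem_filter, hadj]
      rfl
    rw [Finset.sum_congr rfl fun z _ => h3 z] at h2
    omega

/-- A maximum packing M, a perfect matching of the rest and at most one singleton cover the vertices
by |M| + ⌈(n - 3|M|)/2⌉ cliques. The extra 1 is this rounding. -/
lemma Typical.two_mul_chromaticNumber_add_le {D y m : ℕ} {S : Finset (Sym2 (Fin n))}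
    (hS : Typical D y m S) (hm : 16 * m ≤ n) :
    2 * ((graph S)ᶜ).chromaticNumber.toNat + packingNumber S ≤ n + 1 := by
  obtain ⟨M, hM, hMc⟩ := exists_mem_packings_card_eq S
  have hbi := card_biUnion_packing hM
  have hcompl : ((M.biUnion id)ᶜ).card + 3 * M.card = n := by
    rw [← hbi, add_comm, Finset.card_add_card_compl, Fintype.card_fin]
  obtain ⟨W, hW, hWc, heven⟩ : ∃ W ⊆ (M.biUnion id)ᶜ,
      ((M.biUnion id)ᶜ).card ≤ W.card + 1 ∧ Even W.card := by
    rcases Nat.even_or_odd ((M.biUnion id)ᶜ).card with h | h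
    · exact ⟨_, subset_rfl, Nat.le_succ _, h⟩
    · obtain ⟨v, hv⟩ := Finset.card_pos.1 h.pos
      refine ⟨_, Finset.erase_subset v _, ?_, ?_⟩
      · rw [Finset.card_erase_of_mem hv]
        omega
      · rw [Finset.card_erase_of_mem hv]
        exact Nat.Odd.sub_odd h odd_one
  obtain ⟨N, hN⟩ := hS.exists_isPerfectMatching hm hM hW hWc heven
  rw [SimpleGraph.Subgraph.isPerfectMatching_iff] at hN
  choose f hf hfu using hN
  have hff : ∀ w, f (f w) = w := fun w => (hfu _ _ (hf w).symm).symm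
  let e : W → Finset (Fin n) := fun w => {(w : Fin n), (f w : Fin n)}
  -- Every matching edge is the image of both its ends, so there are at most |W|/2 of them.
  have hecard : 2 * (Finset.univ.image e).card ≤ W.card := by
    refine (Finset.mul_card_image_le_card _ 2 ?_).trans_eq (by simp)
    intro t ht
    obtain ⟨w, _, rfl⟩ := Finset.mem_image.1 ht
    have hne : w ≠ f w := (hf w).ne
    rw [← Finset.card_pair hne]
    refine Finset.card_le_card fun x hx => Finset.mem_filter.2 ⟨Finset.mem_univ _, ?_⟩
    rcases Finset.mem_insert.1 hx with rfl | hx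
    · rfl
    · rw [Finset.mem_singleton.1 hx]
      simp only [e, hff, Finset.pair_comm]
  have hcol := colorable_compl_of_cover S
    (M ∪ (Finset.univ.image e ∪ ((M.biUnion id)ᶜ \ W).image singleton)) ?_ ?_
  · have h1 := ENat.toNat_le_of_le_natCast (SimpleGraph.chromaticNumber_le_iff_colorable.2 hcol)
    have h2 := Finset.card_union_le M
      (Finset.univ.image e ∪ ((M.biUnion id)ᶜ \ W).image singleton)
    have h3 := Finset.card_union_le (Finset.univ.image e)
      (((M.biUnion id)ᶜ \ W).image singleton)
    have h4 := (Finset.card_image_le (s := (M.biUnion id)ᶜ \ W)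
      (f := (singleton : Fin n → Finset (Fin n))))
    rw [Finset.card_sdiff_of_subset hW] at h4
    have := Finset.card_le_card hW
    omega
  · intro t ht
    rcases Finset.mem_union.1 ht with ht | ht
    · exact (mem_triangles.1 ((mem_packings.1 hM).1 ht)).2
    · rcases Finset.mem_union.1 ht with ht | ht
      · obtain ⟨w, _, rfl⟩ := Finset.mem_image.1 ht
        have hadj := (graph_adj.1 (SimpleGraph.comap_adj.1 (hf w).adj_sub)).1
        refine pairs_subset_iff.2 fun u hu v hv huv => ?_
        simp only [e, Finset.mem_insert, Finset.mem_singleton] at hu hv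
        rcases hu with rfl | rfl <;> rcases hv with rfl | rfl
        · exact absurd rfl huv
        · exact hadj
        · rwa [Sym2.eq_swap]
        · exact absurd rfl huv
      · obtain ⟨w, _, rfl⟩ := Finset.mem_image.1 ht
        refine pairs_subset_iff.2 fun u hu v hv huv => ?_
        rw [Finset.mem_singleton] at hu hv
        exact absurd (hu.trans hv.symm) huv
  · intro v
    by_cases hvM : v ∈ M.biUnion id
    · obtain ⟨t, ht, hvt⟩ := Finset.mem_biUnion.1 hvM
      exact ⟨t, Finset.mem_union_left _ ht, hvt⟩
    · by_cases hvW : v ∈ W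
      · exact ⟨e ⟨v, hvW⟩, Finset.mem_union_right _ (Finset.mem_union_left _
          (Finset.mem_image_of_mem _ (Finset.mem_univ _))), by simp [e]⟩
      · exact ⟨{v}, Finset.mem_union_right _ (Finset.mem_union_right _
          (Finset.mem_image_of_mem _ (Finset.mem_sdiff.2 ⟨Finset.mem_compl.2 hvM, hvW⟩))),
          by simp⟩

/-! ### Size-biasing and the variance of the triangle count. -/

/-- All triples of vertices. -/
abbrev triples (n : ℕ) : Finset (Finset (Fin n)) := Finset.univ.powersetCard 3

lemma card_triples (n : ℕ) : (triples n).card = n.choose 3 := by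
  simp [triples]

lemma card_pairs_of_mem_triples {t : Finset (Fin n)} (ht : t ∈ triples n) :
    (pairs t).card = 3 := by
  rw [card_pairs, (Finset.mem_powersetCard.1 ht).2]
  rfl

lemma card_triangles_eq_sum (S : Finset (Sym2 (Fin n))) :
    ((triangles S).card : ℝ) = ∑ t ∈ triples n, if pairs t ⊆ S then 1 else 0 := by
  rw [triangles, Finset.card_filter]
  push_cast
  rfl

/-- The size-bias identity for the number of triangles. -/
lemma expect_card_triangles_mul (q : ℝ) (g : Finset (Sym2 (Fin n)) → ℝ) :
    expect q (fun S => (triangles S).card * g S) =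
      ∑ t ∈ triples n, q ^ 3 * expect q (fun S => g (S ∪ pairs t)) := by
  simp only [card_triangles_eq_sum, Finset.sum_mul]
  rw [expect_sum]
  refine Finset.sum_congr rfl fun t ht => ?_
  rw [← card_pairs_of_mem_triples ht, ← expect_subset q (pairs t) g]
  congr 1
  funext S
  split_ifs <;> simp

lemma expect_card_triangles (q : ℝ) :
    expect (ι := Sym2 (Fin n)) q (fun S => (triangles S).card) = n.choose 3 * q ^ 3 := by
  have := expect_card_triangles_mul (n := n) q (fun _ => 1)
  simpa [expect_one, card_triples] using this

/-- A triangle created by adding the edges of `t` either is `t`, was there before, or consists of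
an edge of `t` and two earlier edges to another vertex. -/
lemma card_triangles_union_le (S : Finset (Sym2 (Fin n))) {t : Finset (Fin n)}
    (ht : t ∈ triples n) :
    (triangles (S ∪ pairs t)).card ≤ (triangles S).card + 1 +
      ∑ w ∈ tᶜ, ∑ x ∈ t, if (t.erase x).image (fun u => s(w, u)) ⊆ S then 1 else 0 := by
  have htc := (Finset.mem_powersetCard.1 ht).2
  have hsub : triangles (S ∪ pairs t) ⊆ (triangles S ∪ {t}) ∪ tᶜ.biUnion fun w =>
      (t.filter fun x => (t.erase x).image (fun u => s(w, u)) ⊆ S).image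
        fun x => insert w (t.erase x) := by
    intro s hs
    obtain ⟨hsc, hsS⟩ := mem_triangles.1 hs
    by_cases hst : s = t
    · simp [hst]
    by_cases hsS' : pairs s ⊆ S
    · exact Finset.mem_union_left _ (Finset.mem_union_left _ (mem_triangles.2 ⟨hsc, hsS'⟩))
    refine Finset.mem_union_right _ ?_
    obtain ⟨u, hu, v, hv, huv, huvS⟩ : ∃ u ∈ s, ∃ v ∈ s, u ≠ v ∧ s(u, v) ∉ S := by
      by_contra! h
      exact hsS' (pairs_subset_iff.2 h)
    have huvt := mk_mem_pairs.1
      ((Finset.mem_union.1 (hsS (mk_mem_pairs.2 ⟨hu, hv, huv⟩))).resolve_left huvS)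
    have h2 : 2 ≤ (s ∩ t).card := by
      rw [← Finset.card_pair huv]
      refine Finset.card_le_card fun x hx => ?_
      rcases Finset.mem_insert.1 hx with rfl | hx
      · exact Finset.mem_inter.2 ⟨hu, huvt.1⟩
      · rw [Finset.mem_singleton.1 hx]
        exact Finset.mem_inter.2 ⟨hv, huvt.2.1⟩
    have h3 : (s ∩ t).card ≠ 3 := by
      intro h
      have h1 := Finset.eq_of_subset_of_card_le (Finset.inter_subset_left (s₁ := s) (s₂ := t))
        (by omega)
      have h2 := Finset.eq_of_subset_of_card_le (Finset.inter_subset_right (s₁ := s) (s₂ := t))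
        (by omega)
      exact hst (h1.symm.trans h2)
    have h4 := Finset.card_le_card (Finset.inter_subset_left (s₁ := s) (s₂ := t))
    have h5 := Finset.card_inter_add_card_sdiff s t
    have h6 := Finset.card_inter_add_card_sdiff t s
    rw [Finset.inter_comm] at h6
    -- The triples s and t share exactly two vertices: s exchanges the vertex x of t for a new
    -- vertex w.
    obtain ⟨w, hw⟩ := Finset.card_eq_one.1 (show (s \ t).card = 1 by omega)
    obtain ⟨x, hx⟩ := Finset.card_eq_one.1 (show (t \ s).card = 1 by omega)
    have hw' : ∀ z, (z ∈ s ∧ z ∉ t) ↔ z = w := by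
      intro z
      rw [← Finset.mem_sdiff, hw, Finset.mem_singleton]
    have hx' : ∀ z, (z ∈ t ∧ z ∉ s) ↔ z = x := by
      intro z
      rw [← Finset.mem_sdiff, hx, Finset.mem_singleton]
    have hws := (hw' w).2 rfl
    have hxt := (hx' x).2 rfl
    refine Finset.mem_biUnion.2 ⟨w, Finset.mem_compl.2 hws.2, Finset.mem_image.2
      ⟨x, Finset.mem_filter.2 ⟨hxt.1, ?_⟩, ?_⟩⟩
    · intro e he
      obtain ⟨z, hz, rfl⟩ := Finset.mem_image.1 he
      obtain ⟨hzx, hzt⟩ := Finset.mem_erase.1 hz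
      have hzs : z ∈ s := by
        by_contra hzs
        exact hzx ((hx' z).1 ⟨hzt, hzs⟩)
      have hwz : w ≠ z := fun h => hws.2 (h ▸ hzt)
      refine (Finset.mem_union.1 (hsS (mk_mem_pairs.2 ⟨hws.1, hzs, hwz⟩))).resolve_right ?_
      exact fun h => hws.2 (mk_mem_pairs.1 h).1
    · ext z
      have := hw' z
      have := hx' z
      rw [Finset.mem_insert, Finset.mem_erase]
      tauto
  refine (Finset.card_le_card hsub).trans ((Finset.card_union_le _ _).trans (add_le_add ?_ ?_))
  · exact (Finset.card_union_le _ _).trans_eq (by simp)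
  · refine Finset.card_biUnion_le.trans (Finset.sum_le_sum fun w _ => ?_)
    exact Finset.card_image_le.trans_eq (Finset.card_filter _ _)

/-- By size-biasing, E X² is q³ times the sum over t of the mean triangle count after planting t.
Planting adds at most t itself and, in expectation, 3nq² triangles sharing an edge with t. -/
lemma expect_sq_card_triangles_le {q : ℝ} (h0 : 0 ≤ q) (h1 : q ≤ 1) :
    expect (ι := Sym2 (Fin n)) q (fun S => ((triangles S).card - n.choose 3 * q ^ 3) ^ 2) ≤
      n.choose 3 * q ^ 3 * (1 + 3 * n * q ^ 2) := by
  set l : ℝ := n.choose 3 * q ^ 3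
  have hX := expect_card_triangles (n := n) q
  have hXX : expect (ι := Sym2 (Fin n)) q (fun S => (triangles S).card * (triangles S).card) ≤
      l * (l + 1 + 3 * n * q ^ 2) := by
    rw [expect_card_triangles_mul (n := n) q (fun S => (triangles S).card)]
    have : ∀ t ∈ triples n, q ^ 3 * expect (ι := Sym2 (Fin n)) q
        (fun S => ((triangles (S ∪ pairs t)).card : ℝ)) ≤
        q ^ 3 * (l + 1 + 3 * n * q ^ 2) := by
      intro t ht
      refine mul_le_mul_of_nonneg_left ?_ (by positivity)
      have htc := (Finset.mem_powersetCard.1 ht).2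
      calc expect (ι := Sym2 (Fin n)) q (fun S => ((triangles (S ∪ pairs t)).card : ℝ))
          ≤ expect (ι := Sym2 (Fin n)) q (fun S => ((triangles S).card : ℝ) + 1 +
            ∑ w ∈ tᶜ, ∑ x ∈ t,
              if (t.erase x).image (fun u => s(w, u)) ⊆ S then 1 else 0) := by
            refine expect_mono h0 h1 fun S => ?_
            exact_mod_cast card_triangles_union_le S ht
        _ = l + 1 + ∑ w ∈ tᶜ, ∑ x ∈ t, q ^ 2 := by
            rw [expect_add, expect_add, hX, expect_one, expect_sum]
            congr 1
            refine Finset.sum_congr rfl fun w hw => ?_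
            rw [expect_sum]
            refine Finset.sum_congr rfl fun x hx => ?_
            rw [← prob_eq, prob_subset, Finset.card_image_of_injective, Finset.card_erase_of_mem hx,
              htc]
            intro u v huv
            exact Sym2.congr_right.1 huv
        _ ≤ _ := by
            simp only [Finset.sum_const, htc, nsmul_eq_mul]
            have : ((tᶜ).card : ℝ) ≤ n := by
              exact_mod_cast (Finset.card_le_univ _).trans_eq (Fintype.card_fin n)
            push_cast
            linarith [mul_le_mul_of_nonneg_right this (by positivity : 0 ≤ 3 * q ^ 2)]
    refine (Finset.sum_le_sum this).trans_eq ?_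
    rw [Finset.sum_const, card_triples, nsmul_eq_mul]
    ring
  have e : (fun S : Finset (Sym2 (Fin n)) => ((triangles S).card - l : ℝ) ^ 2) =
      fun S => ((triangles S).card * (triangles S).card - (2 * l) * (triangles S).card : ℝ)
        + l ^ 2 := by
    funext S
    ring
  rw [e, expect_add, expect_sub, expect_const_mul, expect_const, hX]
  nlinarith

/-! ### Anticoncentration of the packing number. -/

/-- Adding a triangle disjoint from a maximum packing increases the packing number. -/
lemma packingNumber_lt_union {S : Finset (Sym2 (Fin n))} {t : Finset (Fin n)}
    (ht : t ∈ triples n) {M : Finset (Finset (Fin n))} (hM : M ∈ packings S)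
    (hMc : M.card = packingNumber S) (hd : Disjoint t (M.biUnion id)) :
    packingNumber S + 1 ≤ packingNumber (S ∪ pairs t) := by
  have htc := (Finset.mem_powersetCard.1 ht).2
  have htM : t ∉ M := by
    intro h
    have h1 : t ⊆ M.biUnion id := Finset.subset_biUnion_of_mem id h
    have h2 := hd.mono_right h1
    rw [disjoint_self] at h2
    rw [h2] at htc
    simp at htc
  rw [← hMc, ← Finset.card_insert_of_notMem htM]
  apply card_le_packingNumber
  rw [mem_packings] at hM ⊢
  refine ⟨Finset.insert_subset (mem_triangles.2 ⟨htc, Finset.subset_union_right⟩) ?_, ?_⟩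
  · intro s hs
    have := mem_triangles.1 (hM.1 hs)
    exact mem_triangles.2 ⟨this.1, this.2.trans Finset.subset_union_left⟩
  · rw [Finset.coe_insert]
    refine hM.2.insert fun s hs _ => ?_
    exact hd.mono_right (Finset.subset_biUnion_of_mem id hs)

lemma packingNumber_mono {S S' : Finset (Sym2 (Fin n))} (h : S ⊆ S') :
    packingNumber S ≤ packingNumber S' := by
  refine Finset.sup_mono fun M hM => ?_
  rw [mem_packings] at hM ⊢
  refine ⟨fun s hs => ?_, hM.2⟩
  have := mem_triangles.1 (hM.1 hs)
  exact mem_triangles.2 ⟨this.1, this.2.trans h⟩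

/-- Few triples meet a given set. -/
lemma card_triples_not_disjoint_le (A : Finset (Fin n)) :
    ((triples n).filter fun t => ¬ Disjoint t A).card ≤ A.card * (n - 1).choose 2 := by
  have h : ((triples n).filter fun t => ¬ Disjoint t A) ⊆
      A.biUnion fun a => (triples n).filter fun t => a ∈ t := by
    intro t ht
    obtain ⟨ht, hd⟩ := Finset.mem_filter.1 ht
    obtain ⟨a, hat, haA⟩ := Finset.not_disjoint_iff.1 hd
    exact Finset.mem_biUnion.2 ⟨a, haA, Finset.mem_filter.2 ⟨ht, hat⟩⟩
  refine (Finset.card_le_card h).trans (Finset.card_biUnion_le_card_mul _ _ _ fun a _ => ?_)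
  have h2 : ((triples n).filter fun t => a ∈ t) ⊆
      ((Finset.univ.erase a).powersetCard 2).image (insert a) := by
    intro t ht
    obtain ⟨ht, hat⟩ := Finset.mem_filter.1 ht
    refine Finset.mem_image.2 ⟨t.erase a, Finset.mem_powersetCard.2 ⟨?_, ?_⟩,
      Finset.insert_erase hat⟩
    · exact Finset.erase_subset_erase _ (Finset.subset_univ _)
    · rw [Finset.card_erase_of_mem hat, (Finset.mem_powersetCard.1 ht).2]
  refine (Finset.card_le_card h2).trans (Finset.card_image_le.trans_eq ?_)
  rw [Finset.card_powersetCard, Finset.card_erase_of_mem (Finset.mem_univ _), Finset.card_univ,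
    Fintype.card_fin]

/-- The truncation of `x` to the interval `[0, L]`. -/
noncomputable def clamp (L x : ℝ) : ℝ := max 0 (min x L)

/-- Anticoncentration of the triangle packing number. -/
lemma mul_prob_packingNumber_le {q : ℝ} (h0 : 0 ≤ q) (h1 : q ≤ 1) {a L : ℝ} (hL : 0 ≤ L)
    (hn : 3 ≤ n) :
    n.choose 3 * q ^ 3 * prob (ι := Sym2 (Fin n)) q
        (fun S => a ≤ packingNumber S ∧ (packingNumber S : ℝ) ≤ a + L) ≤
      n.choose 3 * q ^ 3 * (9 * (n.choose 3 * q ^ 3) / n) +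
      (L + 1) * √(n.choose 3 * q ^ 3 * (1 + 3 * n * q ^ 2)) := by
  set l : ℝ := n.choose 3 * q ^ 3 with hl
  have hl0 : 0 ≤ l := by positivity
  -- The ceiling is L + 1 and not L, so that a unit increase of the packing number from anywhere in
  -- [a, a + L] is seen in full.
  let ψ : Finset (Sym2 (Fin n)) → ℝ := fun S => clamp (L + 1) (packingNumber S - a)
  have hψ0 : ∀ S, 0 ≤ ψ S := fun S => le_max_left _ _
  have hψ1 : ∀ S, ψ S ≤ L + 1 := fun S => max_le (by linarith) (min_le_right _ _)
  have hψm : ∀ S S', S ⊆ S' → ψ S ≤ ψ S' := by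
    intro S S' h
    have : (packingNumber S : ℝ) ≤ packingNumber S' := by exact_mod_cast packingNumber_mono h
    exact max_le_max le_rfl (min_le_min (by linarith) le_rfl)
  -- upper bound for the covariance
  have hupper : expect q (fun S => ((triangles S).card - l) * ψ S) ≤
      (L + 1) * √(l * (1 + 3 * n * q ^ 2)) := by
    calc expect q (fun S => ((triangles S).card - l) * ψ S)
        ≤ expect q (fun S => (L + 1) * |((triangles S).card - l : ℝ)|) := by
          refine expect_mono h0 h1 fun S => ?_
          rw [mul_comm]
          exact (mul_le_mul_of_nonneg_left (le_abs_self _) (hψ0 S)).trans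
            (mul_le_mul_of_nonneg_right (hψ1 S) (abs_nonneg _))
      _ ≤ _ := by
          rw [expect_const_mul]
          refine mul_le_mul_of_nonneg_left ?_ (by linarith)
          exact (expect_abs_le_sqrt h0 h1 _).trans
            (Real.sqrt_le_sqrt (expect_sq_card_triangles_le h0 h1))
  -- lower bound for the covariance
  have hlower : l * prob (ι := Sym2 (Fin n)) q
        (fun S => a ≤ packingNumber S ∧ (packingNumber S : ℝ) ≤ a + L) - l * (9 * l / n) ≤
      expect q (fun S => ((triangles S).card - l) * ψ S) := by
    have e : expect q (fun S => ((triangles S).card - l) * ψ S) =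
        q ^ 3 * expect q (fun S => ∑ t ∈ triples n, (ψ (S ∪ pairs t) - ψ S)) := by
      have e1 : (fun S : Finset (Sym2 (Fin n)) => ((triangles S).card - l) * ψ S) =
          fun S => (triangles S).card * ψ S - l * ψ S := by
        funext S
        ring
      rw [e1, expect_sub, expect_card_triangles_mul, expect_const_mul, expect_sum]
      simp only [expect_sub]
      rw [Finset.sum_sub_distrib, Finset.sum_const, card_triples, ← Finset.mul_sum, nsmul_eq_mul,
        hl]
      ring
    -- In the window, every triple missing a maximum packing contributes at least 1. The packing
    -- covers at most 3X vertices, each in C(n-1,2) = (3/n)·C(n,3) triples, which gives the loss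
    -- 9X/n; outside the window monotonicity of ψ suffices.
    have hpt : ∀ S : Finset (Sym2 (Fin n)),
        n.choose 3 * (if a ≤ packingNumber S ∧ (packingNumber S : ℝ) ≤ a + L then 1 else 0) -
          n.choose 3 * (9 / n) * (triangles S).card ≤
        ∑ t ∈ triples n, (ψ (S ∪ pairs t) - ψ S) := by
      intro S
      have hs0 : 0 ≤ ∑ t ∈ triples n, (ψ (S ∪ pairs t) - ψ S) :=
        Finset.sum_nonneg fun t _ => sub_nonneg.2 (hψm _ _ Finset.subset_union_left)
      split_ifs with hS
      · obtain ⟨M, hM, hMc⟩ := exists_mem_packings_card_eq S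
        have hsum : (((triples n).filter fun t => Disjoint t (M.biUnion id)).card : ℝ) ≤
            ∑ t ∈ triples n, (ψ (S ∪ pairs t) - ψ S) := by
          rw [Finset.card_filter]
          push_cast
          refine Finset.sum_le_sum fun t ht => ?_
          split_ifs with hd
          · have : (packingNumber S : ℝ) + 1 ≤ packingNumber (S ∪ pairs t) := by
              exact_mod_cast packingNumber_lt_union ht hM hMc hd
            have h1 : ψ S = packingNumber S - a := by
              simp only [ψ, clamp]
              rw [min_eq_left (by linarith [hS.2]), max_eq_right (by linarith [hS.1])]
            have h2 : packingNumber S - a + 1 ≤ ψ (S ∪ pairs t) :=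
              (le_min (by linarith) (by linarith [hS.2])).trans (le_max_right _ _)
            linarith
          · exact sub_nonneg.2 (hψm _ _ Finset.subset_union_left)
        have hcard : (((triples n).filter fun t => Disjoint t (M.biUnion id)).card : ℝ) +
            ((triples n).filter fun t => ¬ Disjoint t (M.biUnion id)).card = n.choose 3 := by
          rw [← card_triples]
          exact_mod_cast Finset.card_filter_add_card_filter_not _
        have hbad : ((((triples n).filter fun t => ¬ Disjoint t (M.biUnion id)).card : ℕ) : ℝ) ≤
            n.choose 3 * (9 / n) * (triangles S).card := by
          have h1 := card_triples_not_disjoint_le (M.biUnion id)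
          rw [card_biUnion_packing hM, hMc] at h1
          have h2 := packingNumber_le_card_triangles S
          have h3 : (n : ℝ) * (n - 1).choose 2 = n.choose 3 * 3 := by
            have := Nat.add_one_mul_choose_eq (n - 1) 2
            rw [Nat.sub_add_cancel (by omega)] at this
            exact_mod_cast this
          have h4 : (n.choose 3 : ℝ) * (9 / n) = 3 * (n - 1).choose 2 := by
            have : (n : ℝ) ≠ 0 := by
              have : n ≠ 0 := by omega
              exact_mod_cast this
            field_simp
            linarith
          rw [h4]
          have h5 : 3 * packingNumber S * (n - 1).choose 2 ≤
              3 * (n - 1).choose 2 * (triangles S).card := by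
            rw [mul_right_comm]
            exact Nat.mul_le_mul_left _ h2
          exact_mod_cast h1.trans h5
        linarith
      · have : (0 : ℝ) ≤ n.choose 3 * (9 / n) * (triangles S).card := by positivity
        linarith
    rw [e]
    have h2 := mul_le_mul_of_nonneg_left (expect_mono h0 h1 hpt) (by positivity : 0 ≤ q ^ 3)
    rw [expect_sub, expect_const_mul, expect_const_mul, expect_card_triangles, ← prob_eq] at h2
    refine le_trans (le_of_eq ?_) h2
    rw [hl]
    ring
  linarith

/-! ### Union bounds: random graphs are typical. -/

lemma choose_mul_pow_le_exp_neg {N k : ℕ} {x : ℝ} (hx : 0 ≤ x)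
    (h : Real.exp 2 * (N * x) ≤ k) : N.choose k * x ^ k ≤ Real.exp (-k) := by
  have h1 : (N.choose k : ℝ) * x ^ k ≤ (N * x) ^ k / k.factorial := by
    rw [mul_pow, mul_div_right_comm]
    exact mul_le_mul_of_nonneg_right (Nat.choose_le_pow_div k N) (by positivity)
  have h2 : (N * x) ^ k ≤ (k * Real.exp (-2)) ^ k := by
    refine pow_le_pow_left₀ (by positivity) ?_ k
    rw [Real.exp_neg, ← div_eq_mul_inv, le_div_iff₀ (Real.exp_pos _)]
    linarith
  have h3 : (k : ℝ) ^ k / k.factorial ≤ Real.exp k :=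
    Real.pow_div_factorial_le_exp _ (Nat.cast_nonneg k) k
  calc (N.choose k : ℝ) * x ^ k ≤ (N * x) ^ k / k.factorial := h1
    _ ≤ (k * Real.exp (-2)) ^ k / k.factorial := by gcongr
    _ = (k : ℝ) ^ k / k.factorial * Real.exp (-2 * k) := by
      rw [mul_pow, ← Real.exp_nat_mul]
      ring_nf
    _ ≤ Real.exp k * Real.exp (-2 * k) := by gcongr
    _ = Real.exp (-k) := by
      rw [← Real.exp_add]
      ring_nf

lemma prob_le_card_inter_le {ι : Type*} [Fintype ι] [DecidableEq ι] {q : ℝ} (h0 : 0 ≤ q)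
    (h1 : q ≤ 1) (A : Finset ι) (k : ℕ) :
    prob q (fun S => k ≤ (A ∩ S).card) ≤ A.card.choose k * q ^ k := by
  have h : ∀ S : Finset ι, k ≤ (A ∩ S).card → ∃ B ∈ A.powersetCard k, B ⊆ S := by
    intro S hS
    obtain ⟨B, hB, hBk⟩ := Finset.exists_subset_card_eq hS
    exact ⟨B, Finset.mem_powersetCard.2 ⟨hB.trans Finset.inter_subset_left, hBk⟩,
      hB.trans Finset.inter_subset_right⟩
  refine (prob_mono h0 h1 h).trans ((prob_exists_le h0 h1 _ fun B S => B ⊆ S).trans_eq ?_)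
  rw [← Finset.card_powersetCard, ← nsmul_eq_mul, ← Finset.sum_const]
  refine Finset.sum_congr rfl fun B hB => ?_
  rw [prob_subset, (Finset.mem_powersetCard.1 hB).2]

variable {q : ℝ}

lemma prob_exists_four_clique_le (h0 : 0 ≤ q) (h1 : q ≤ 1) :
    prob (ι := Sym2 (Fin n)) q (fun S => ∃ t : Finset (Fin n), t.card = 4 ∧ pairs t ⊆ S) ≤
      n ^ 4 * q ^ 6 := by
  have h : ∀ S : Finset (Sym2 (Fin n)), (∃ t : Finset (Fin n), t.card = 4 ∧ pairs t ⊆ S) →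
      ∃ t ∈ Finset.univ.powersetCard 4, pairs t ⊆ S := by
    rintro S ⟨t, ht, htS⟩
    exact ⟨t, by simpa using ht, htS⟩
  refine (prob_mono h0 h1 h).trans ((prob_exists_le h0 h1 _ fun t S => pairs t ⊆ S).trans ?_)
  have h2 : ∀ t ∈ Finset.univ.powersetCard 4,
      prob (ι := Sym2 (Fin n)) q (fun S => pairs t ⊆ S) = q ^ 6 := by
    intro t ht
    rw [prob_subset, card_pairs, (Finset.mem_powersetCard.1 ht).2]
    rfl
  rw [Finset.sum_congr rfl h2, Finset.sum_const, Finset.card_powersetCard, Finset.card_univ,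
    Fintype.card_fin, nsmul_eq_mul]
  refine mul_le_mul_of_nonneg_right ?_ (by positivity)
  exact_mod_cast Nat.choose_le_pow n 4

lemma prob_many_triangles_le (h0 : 0 ≤ q) (h1 : q ≤ 1) (hn : 0 < n) :
    prob (ι := Sym2 (Fin n)) q (fun S => n ≤ 16 * (triangles S).card) ≤ 16 * (n ^ 2 * q ^ 3) := by
  have hn' : (0 : ℝ) < n := by exact_mod_cast hn
  have h : ∀ S : Finset (Sym2 (Fin n)), n ≤ 16 * (triangles S).card →
      (n / 16 : ℝ) ≤ (triangles S).card := by
    intro S hS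
    rw [div_le_iff₀ (by norm_num), mul_comm]
    exact_mod_cast hS
  refine (prob_mono h0 h1 h).trans ((prob_le_expect_div h0 h1
    (fun S => Nat.cast_nonneg (triangles S).card) (by positivity)).trans ?_)
  rw [expect_card_triangles, div_le_iff₀ (by positivity)]
  have h3 : (n.choose 3 : ℝ) ≤ n ^ 3 := by exact_mod_cast Nat.choose_le_pow n 3
  calc (n.choose 3 : ℝ) * q ^ 3 ≤ n ^ 3 * q ^ 3 := by gcongr
    _ = _ := by ring

/-- The lower-tail bound for the n - 1 possible edges at a vertex. The factor 2^k is harmless when k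
is a small fraction of nq. -/
lemma prob_exists_degree_lt_le (h0 : 0 ≤ q) (h1 : q ≤ 1) (hn : 0 < n) (k : ℕ) :
    prob (ι := Sym2 (Fin n)) q
        (fun S => ∃ v, (Finset.univ.filter ((graph S).Adj v)).card < k) ≤
      n * (2 ^ k * Real.exp (-(q / 2 * (n - 1)))) := by
  let A : Fin n → Finset (Sym2 (Fin n)) := fun v => (Finset.univ.erase v).image fun w => s(v, w)
  have hA : ∀ v, (A v).card = n - 1 := by
    intro v
    rw [Finset.card_image_of_injective _ (fun _ _ h => Sym2.congr_right.1 h),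
      Finset.card_erase_of_mem (Finset.mem_univ _), Finset.card_univ, Fintype.card_fin]
  have h : ∀ S : Finset (Sym2 (Fin n)),
      (∃ v, (Finset.univ.filter ((graph S).Adj v)).card < k) →
      ∃ v ∈ Finset.univ, (A v ∩ S).card < k := by
    rintro S ⟨v, hv⟩
    refine ⟨v, Finset.mem_univ _, lt_of_le_of_lt ?_ hv⟩
    have : A v ∩ S ⊆ (Finset.univ.filter ((graph S).Adj v)).image fun w => s(v, w) := by
      intro e he
      obtain ⟨heA, heS⟩ := Finset.mem_inter.1 he
      obtain ⟨w, hw, rfl⟩ := Finset.mem_image.1 heA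
      exact Finset.mem_image_of_mem _ (Finset.mem_filter.2 ⟨Finset.mem_univ _,
        graph_adj.2 ⟨heS, (Finset.ne_of_mem_erase hw).symm⟩⟩)
    exact (Finset.card_le_card this).trans Finset.card_image_le
  refine (prob_mono h0 h1 h).trans ((prob_exists_le h0 h1 _
    fun v S => (A v ∩ S).card < k).trans ?_)
  have h2 : ∀ v ∈ Finset.univ, prob q (fun S => (A v ∩ S).card < k) ≤
      2 ^ k * Real.exp (-(q / 2 * (n - 1))) := by
    intro v _
    refine (prob_card_inter_lt_le h0 h1 (A v) k).trans ?_
    refine mul_le_mul_of_nonneg_left ?_ (by positivity)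
    rw [hA]
    calc (1 - q / 2) ^ (n - 1) ≤ Real.exp (-(q / 2)) ^ (n - 1) :=
          pow_le_pow_left₀ (by linarith) (Real.one_sub_le_exp_neg _) _
      _ = _ := by
          rw [← Real.exp_nat_mul, Nat.cast_sub hn, Nat.cast_one]
          ring_nf
  refine (Finset.sum_le_sum h2).trans_eq ?_
  simp

/-- Disjointness of A and B makes the m² pairs between them distinct, so all are absent with
probability (1 - q)^(m²). -/
lemma prob_exists_not_joined_le (h0 : 0 ≤ q) (h1 : q ≤ 1) (m : ℕ) :
    prob (ι := Sym2 (Fin n)) q (fun S => ∃ A B : Finset (Fin n), Disjoint A B ∧ A.card = m ∧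
        B.card = m ∧ ∀ a ∈ A, ∀ b ∈ B, s(a, b) ∉ S) ≤
      n ^ m * n ^ m * Real.exp (-(q * m * m)) := by
  let E : Finset (Fin n) × Finset (Fin n) → Finset (Sym2 (Fin n)) :=
    fun x => (x.1 ×ˢ x.2).image fun y => s(y.1, y.2)
  let P := ((Finset.univ.powersetCard m) ×ˢ (Finset.univ.powersetCard m)).filter
    fun x : Finset (Fin n) × Finset (Fin n) => Disjoint x.1 x.2
  have h : ∀ S : Finset (Sym2 (Fin n)), (∃ A B : Finset (Fin n), Disjoint A B ∧ A.card = m ∧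
        B.card = m ∧ ∀ a ∈ A, ∀ b ∈ B, s(a, b) ∉ S) → ∃ x ∈ P, Disjoint (E x) S := by
    rintro S ⟨A, B, hAB, hA, hB, hS⟩
    refine ⟨(A, B), by simp [P, hAB, hA, hB], Finset.disjoint_left.2 fun e he => ?_⟩
    obtain ⟨y, hy, rfl⟩ := Finset.mem_image.1 he
    exact hS _ (Finset.mem_product.1 hy).1 _ (Finset.mem_product.1 hy).2
  refine (prob_mono h0 h1 h).trans ((prob_exists_le h0 h1 _ fun x S => Disjoint (E x) S).trans ?_)
  have h2 : ∀ x ∈ P, prob q (fun S => Disjoint (E x) S) ≤ Real.exp (-(q * m * m)) := by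
    rintro ⟨A, B⟩ hx
    obtain ⟨hx, hAB⟩ := Finset.mem_filter.1 hx
    obtain ⟨hA, hB⟩ := Finset.mem_product.1 hx
    have hA := (Finset.mem_powersetCard.1 hA).2
    have hB := (Finset.mem_powersetCard.1 hB).2
    have hE : (E (A, B)).card = m * m := by
      rw [Finset.card_image_of_injOn, Finset.card_product, hA, hB]
      rintro ⟨a, b⟩ hab ⟨a', b'⟩ hab' heq
      obtain ⟨ha, hb⟩ := Finset.mem_product.1 (Finset.mem_coe.1 hab)
      obtain ⟨ha', hb'⟩ := Finset.mem_product.1 (Finset.mem_coe.1 hab')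
      rcases Sym2.eq_iff.1 heq with ⟨h, h'⟩ | ⟨h, h'⟩
      · exact Prod.ext h h'
      · dsimp only at h ha hb'
        exact absurd hb' (h ▸ Finset.disjoint_left.1 hAB ha)
    rw [prob_disjoint, hE]
    calc (1 - q) ^ (m * m) ≤ Real.exp (-q) ^ (m * m) :=
          pow_le_pow_left₀ (by linarith) (Real.one_sub_le_exp_neg _) _
      _ = _ := by
          rw [← Real.exp_nat_mul]
          push_cast
          ring_nf
  refine (Finset.sum_le_sum h2).trans ?_
  rw [Finset.sum_const, nsmul_eq_mul]
  refine mul_le_mul_of_nonneg_right ?_ (Real.exp_pos _).le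
  have h3 : P.card ≤ n ^ m * n ^ m := by
    refine (Finset.card_filter_le _ _).trans ?_
    rw [Finset.card_product, Finset.card_powersetCard, Finset.card_univ, Fintype.card_fin]
    exact Nat.mul_le_mul (Nat.choose_le_pow n m) (Nat.choose_le_pow n m)
  exact_mod_cast h3

/-- A given Z is dense with probability at most n^(-2|Z|). Summed over all Z this is (1 + n⁻²)^n ≤
e^(1/n), and omitting the empty set subtracts 1. -/
lemma prob_exists_dense_le (h0 : 0 ≤ q) (h1 : q ≤ 1) {m D : ℕ} (hn : 0 < n)
    (hm : 4 * Real.exp 2 * (m * q) ≤ D) (hD : 8 * Real.log n ≤ D) :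
    prob (ι := Sym2 (Fin n)) q (fun S => ∃ Z : Finset (Fin n), Z.Nonempty ∧ Z.card < 2 * m ∧
        Z.card * D ≤ 4 * (pairs Z ∩ S).card) ≤ Real.exp (1 / n) - 1 := by
  have hn' : (0 : ℝ) < n := by exact_mod_cast hn
  let P := Finset.univ.filter fun Z : Finset (Fin n) => Z.Nonempty ∧ Z.card < 2 * m
  -- Adding 3 before dividing by 4 gives the ceiling of |Z|·D/4.
  have h : ∀ S : Finset (Sym2 (Fin n)), (∃ Z : Finset (Fin n), Z.Nonempty ∧ Z.card < 2 * m ∧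
        Z.card * D ≤ 4 * (pairs Z ∩ S).card) →
      ∃ Z ∈ P, (Z.card * D + 3) / 4 ≤ (pairs Z ∩ S).card := by
    rintro S ⟨Z, hZ, hZm, hZS⟩
    exact ⟨Z, by simp [P, hZ, hZm], by omega⟩
  refine (prob_mono h0 h1 h).trans ((prob_exists_le h0 h1 _
    fun Z S => (Z.card * D + 3) / 4 ≤ (pairs Z ∩ S).card).trans ?_)
  have h2 : ∀ Z ∈ P, prob q (fun S => (Z.card * D + 3) / 4 ≤ (pairs Z ∩ S).card) ≤
      (1 / (n : ℝ) ^ 2) ^ Z.card := by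
    intro Z hZ
    obtain ⟨_, hZ0, hZm⟩ := Finset.mem_filter.1 hZ
    set t := Z.card
    have hs : (t * D / 4 : ℝ) ≤ ((t * D + 3) / 4 : ℕ) := by
      have : t * D ≤ 4 * ((t * D + 3) / 4) := by omega
      have : (t * D : ℝ) ≤ 4 * ((t * D + 3) / 4 : ℕ) := by exact_mod_cast this
      linarith
    have htm : (t : ℝ) ≤ 2 * m := by exact_mod_cast hZm.le
    refine (prob_le_card_inter_le h0 h1 _ _).trans ((choose_mul_pow_le_exp_neg h0 ?_).trans ?_)
    · rw [card_pairs]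
      have hc : (t.choose 2 : ℝ) ≤ t * m := by
        rw [Nat.cast_choose_two]
        nlinarith [Nat.cast_nonneg (α := ℝ) t]
      calc Real.exp 2 * (t.choose 2 * q) ≤ Real.exp 2 * (t * m * q) := by gcongr
        _ = t * (4 * Real.exp 2 * (m * q)) / 4 := by ring
        _ ≤ t * D / 4 := by gcongr
        _ ≤ _ := hs
    · have : (1 / (n : ℝ) ^ 2) ^ t = Real.exp (-(t * (2 * Real.log n))) := by
        rw [Real.exp_neg, Real.exp_nat_mul, show (2 : ℝ) * Real.log n = (2 : ℕ) * Real.log n by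
          norm_num, Real.exp_nat_mul, Real.exp_log hn', one_div, inv_pow]
      rw [this, Real.exp_le_exp, neg_le_neg_iff]
      refine le_trans ?_ hs
      have := mul_le_mul_of_nonneg_left hD (Nat.cast_nonneg (α := ℝ) t)
      linarith
  refine (Finset.sum_le_sum h2).trans ?_
  have h3 : ∑ Z : Finset (Fin n), (1 / (n : ℝ) ^ 2) ^ Z.card = (1 + 1 / (n : ℝ) ^ 2) ^ n := by
    have := Fintype.sum_pow_mul_eq_add_pow (Fin n) (1 / (n : ℝ) ^ 2) 1
    simpa [add_comm] using this
  have h4 : (1 + 1 / (n : ℝ) ^ 2) ^ n ≤ Real.exp (1 / n) := by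
    calc (1 + 1 / (n : ℝ) ^ 2) ^ n ≤ Real.exp (1 / (n : ℝ) ^ 2) ^ n := by
          refine pow_le_pow_left₀ (by positivity) ?_ _
          linarith [Real.add_one_le_exp (1 / (n : ℝ) ^ 2)]
      _ = _ := by
          rw [← Real.exp_nat_mul]
          congr 1
          field_simp
  have h5 : ∑ Z ∈ P, (1 / (n : ℝ) ^ 2) ^ Z.card + 1 ≤
      ∑ Z : Finset (Fin n), (1 / (n : ℝ) ^ 2) ^ Z.card := by
    rw [← Finset.sum_erase_add _ _ (Finset.mem_univ (∅ : Finset (Fin n)))]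
    refine add_le_add (Finset.sum_le_sum_of_subset_of_nonneg ?_ fun _ _ _ => by positivity)
      (by simp)
    intro Z hZ
    have := (Finset.mem_filter.1 hZ).2.1
    simp [this.ne_empty]
  linarith

/-- Since y disjoint triangles avoiding v, each with a chosen edge to v, use 4y distinct edges, a
given configuration has probability q^(4y). There are at most n³ pairs of a triangle and an endpoint
to choose from. -/
lemma prob_exists_packing_degree_le (h0 : 0 ≤ q) (h1 : q ≤ 1) {y : ℕ}
    (hy : Real.exp 2 * (n ^ 3 * q ^ 4) ≤ y) :
    prob (ι := Sym2 (Fin n)) q (fun S => ∃ v, ∃ M ∈ packings S, v ∉ M.biUnion id ∧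
        y ≤ (M.filter fun t => ∃ u ∈ t, s(v, u) ∈ S).card) ≤ n * Real.exp (-y) := by
  let T := (triples n).sigma fun t => t
  let E : Fin n → (Σ _ : Finset (Fin n), Fin n) → Finset (Sym2 (Fin n)) :=
    fun v x => insert s(v, x.2) (pairs x.1)
  let P : Fin n → Finset (Finset (Σ _ : Finset (Fin n), Fin n)) := fun v =>
    (T.powersetCard y).filter fun F => ∀ x ∈ F, v ∉ x.1 ∧ ∀ x' ∈ F, x ≠ x' → Disjoint x.1 x'.1
  have hT : T.card ≤ n ^ 3 := by
    rw [Finset.card_sigma, Finset.sum_const_nat (m := 3) fun t ht =>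
      (Finset.mem_powersetCard.1 ht).2, card_triples]
    have := Nat.choose_le_pow_div (α := ℝ) 3 n
    rw [le_div_iff₀ (by positivity)] at this
    have h6 : n.choose 3 * Nat.factorial 3 ≤ n ^ 3 := by exact_mod_cast this
    rw [show Nat.factorial 3 = 6 from rfl] at h6
    omega
  have h : ∀ S : Finset (Sym2 (Fin n)), (∃ v, ∃ M ∈ packings S, v ∉ M.biUnion id ∧
        y ≤ (M.filter fun t => ∃ u ∈ t, s(v, u) ∈ S).card) →
      ∃ x ∈ Finset.univ.sigma P, x.2.biUnion (E x.1) ⊆ S := by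
    rintro S ⟨v, M, hM, hv, hMy⟩
    rw [mem_packings] at hM
    obtain ⟨M', hM', hM'y⟩ := Finset.exists_subset_card_eq hMy
    have hM'M : M' ⊆ M := hM'.trans (Finset.filter_subset _ _)
    have hex : ∀ t : Finset (Fin n), ∃ u, t ∈ M' → u ∈ t ∧ s(v, u) ∈ S := by
      intro t
      by_cases ht : t ∈ M'
      · obtain ⟨u, hu⟩ := (Finset.mem_filter.1 (hM' ht)).2
        exact ⟨u, fun _ => hu⟩
      · exact ⟨v, fun h => absurd h ht⟩
    choose f hf using hex
    have hinj : Function.Injective fun t => (⟨t, f t⟩ : Σ _ : Finset (Fin n), Fin n) :=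
      fun t t' h => congrArg Sigma.fst h
    refine ⟨⟨v, M'.map ⟨_, hinj⟩⟩, ?_, ?_⟩
    · refine Finset.mem_sigma.2 ⟨Finset.mem_univ _, Finset.mem_filter.2 ⟨?_, ?_⟩⟩
      · refine Finset.mem_powersetCard.2 ⟨fun x hx => ?_, by rw [Finset.card_map, hM'y]⟩
        obtain ⟨t, ht, rfl⟩ := Finset.mem_map.1 hx
        refine Finset.mem_sigma.2 ⟨?_, (hf t ht).1⟩
        exact Finset.mem_powersetCard.2
          ⟨Finset.subset_univ _, (mem_triangles.1 (hM.1 (hM'M ht))).1⟩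
      · intro x hx
        obtain ⟨t, ht, rfl⟩ := Finset.mem_map.1 hx
        refine ⟨fun hvt => hv (Finset.mem_biUnion.2 ⟨t, hM'M ht, hvt⟩), fun x' hx' hne => ?_⟩
        obtain ⟨t', ht', rfl⟩ := Finset.mem_map.1 hx'
        exact hM.2 (hM'M ht) (hM'M ht') fun h => hne (h ▸ rfl)
    · refine Finset.biUnion_subset.2 fun x hx => ?_
      obtain ⟨t, ht, rfl⟩ := Finset.mem_map.1 hx
      exact Finset.insert_subset (hf t ht).2 (mem_triangles.1 (hM.1 (hM'M ht))).2
  refine (prob_mono h0 h1 h).trans ((prob_exists_le h0 h1 _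
    fun (x : Σ _ : Fin n, Finset (Σ _ : Finset (Fin n), Fin n)) S =>
      x.2.biUnion (E x.1) ⊆ S).trans ?_)
  have h2 : ∀ x ∈ Finset.univ.sigma P, prob q (fun S => x.2.biUnion (E x.1) ⊆ S) =
      (q ^ 4) ^ y := by
    rintro ⟨v, F⟩ hx
    obtain ⟨hF, hFd⟩ := Finset.mem_filter.1 (Finset.mem_sigma.1 hx).2
    obtain ⟨hFT, hFy⟩ := Finset.mem_powersetCard.1 hF
    have hcard : (F.biUnion (E v)).card = 4 * y := by
      rw [Finset.card_biUnion, Finset.sum_const_nat (m := 4), hFy, mul_comm]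
      · intro x hx
        obtain ⟨hxt, hxu⟩ := Finset.mem_sigma.1 (hFT hx)
        rw [Finset.card_insert_of_notMem, card_pairs_of_mem_triples hxt]
        exact fun h => (hFd x hx).1 (mk_mem_pairs.1 h).1
      · intro x hx x' hx' hne
        have hd := (hFd x hx).2 x' hx' hne
        have hxu := (Finset.mem_sigma.1 (hFT hx)).2
        have hxu' := (Finset.mem_sigma.1 (hFT hx')).2
        rw [Function.onFun, Finset.disjoint_left]
        intro e he he'
        rcases Finset.mem_insert.1 he with rfl | he
        · rcases Finset.mem_insert.1 he' with h | h
          · exact Finset.disjoint_left.1 hd hxu (Sym2.congr_right.1 h ▸ hxu')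
          · exact (hFd x' hx').1 (mk_mem_pairs.1 h).1
        · rcases Finset.mem_insert.1 he' with rfl | h
          · exact (hFd x hx).1 (mk_mem_pairs.1 he).1
          · induction e with
            | _ a b =>
              exact Finset.disjoint_left.1 hd (mk_mem_pairs.1 he).1 (mk_mem_pairs.1 h).1
    rw [prob_subset, hcard, pow_mul]
  rw [Finset.sum_congr rfl h2, Finset.sum_const, Finset.card_sigma, nsmul_eq_mul]
  have h3 : ∑ v, (P v).card ≤ n * T.card.choose y := by
    refine (Finset.sum_le_card_nsmul _ _ (T.card.choose y) fun v _ => ?_).trans_eq (by simp)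
    exact (Finset.card_filter_le _ _).trans_eq (Finset.card_powersetCard _ _)
  calc ((∑ v, (P v).card : ℕ) : ℝ) * (q ^ 4) ^ y
      ≤ ((n * T.card.choose y : ℕ) : ℝ) * (q ^ 4) ^ y := by gcongr
    _ = n * (T.card.choose y * (q ^ 4) ^ y) := by push_cast; ring
    _ ≤ n * Real.exp (-y) := by
        refine mul_le_mul_of_nonneg_left (choose_mul_pow_le_exp_neg (by positivity) ?_)
          (Nat.cast_nonneg n)
        refine le_trans ?_ hy
        have : (T.card : ℝ) ≤ n ^ 3 := by exact_mod_cast hT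
        gcongr

lemma sixteen_mul_ceil_le (hq : 0 < q) (hl : 1 ≤ Real.log n) (hd : 2000 * Real.log n ≤ n * q)
    (h1 : q ≤ 1) : 16 * ⌈3 * Real.log n / q⌉₊ ≤ n := by
  have h2 := (Nat.ceil_lt_add_one (a := 3 * Real.log n / q)
    (div_nonneg (by linarith) hq.le)).le
  have h3 : 3 * Real.log n / q ≤ 3 / 2000 * n := by
    rw [div_le_iff₀ hq]
    linarith
  have h4 : (n : ℝ) * q ≤ n := mul_le_of_le_one_right (Nat.cast_nonneg n) h1
  have : (16 * ⌈3 * Real.log n / q⌉₊ : ℝ) ≤ n := by linarith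
  exact_mod_cast this

/-- Sparse random graphs are typical with high probability. -/
lemma prob_not_typical_le (h1 : q ≤ 1) (hq : 0 < q) (hl : 1 ≤ Real.log n)
    (hd : 2000 * Real.log n ≤ n * q) (hx : n ^ 2 * q ^ 3 ≤ (1 / 300 : ℝ)) :
    prob (ι := Sym2 (Fin n)) q (fun S => ¬ Typical ⌈n * q / 16⌉₊ ⌈n * q / 32⌉₊
      ⌈3 * Real.log n / q⌉₊ S) ≤
      (n ^ 2 * q ^ 3) ^ 2 + 16 * (n ^ 2 * q ^ 3) + 4 / n + (Real.exp (1 / n) - 1) := by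
  have h0 := hq.le
  have hn : 0 < n := by
    rcases Nat.eq_zero_or_pos n with rfl | h
    · norm_num at hl
    · exact h
  have hn' : (0 : ℝ) < n := by exact_mod_cast hn
  -- The constants balance three demands: D + 3y + 1 ≤ nq/4 lies well below the mean degree, qm ≥ 3
  -- log n beats the n^(2m) pairs of m-sets, and mq ≤ 3 log n + 1 is a small fraction of D.
  set D := ⌈n * q / 16⌉₊
  set y := ⌈n * q / 32⌉₊
  set m := ⌈3 * Real.log n / q⌉₊
  have hD : n * q / 16 ≤ D := Nat.le_ceil _
  have hD' : (D : ℝ) ≤ n * q / 16 + 1 := (Nat.ceil_lt_add_one (by positivity)).le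
  have hy : n * q / 32 ≤ y := Nat.le_ceil _
  have hy' : (y : ℝ) ≤ n * q / 32 + 1 := (Nat.ceil_lt_add_one (by positivity)).le
  have hm : 3 * Real.log n / q ≤ m := Nat.le_ceil _
  have hm' : (m : ℝ) ≤ 3 * Real.log n / q + 1 :=
    (Nat.ceil_lt_add_one (div_nonneg (by linarith) h0)).le
  have hmq : 3 * Real.log n ≤ q * m := by
    rw [div_le_iff₀ hq] at hm
    linarith
  have hmq' : m * q ≤ 3 * Real.log n + 1 := by
    have := mul_le_mul_of_nonneg_right hm' h0
    rw [add_mul, div_mul_cancel₀ _ hq.ne'] at this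
    linarith
  have hm1 : (1 : ℝ) ≤ m := by
    have : 0 < m := Nat.ceil_pos.2 (by positivity)
    exact_mod_cast this
  have he : Real.exp 2 ≤ 7.5 := by
    have := Real.exp_one_lt_d9
    rw [show (2 : ℝ) = 1 + 1 by norm_num, Real.exp_add]
    nlinarith [Real.exp_pos 1]
  have hexp : ∀ c : ℝ, 2 * Real.log n ≤ c → n * Real.exp (-c) ≤ 1 / n := by
    intro c hc
    calc (n : ℝ) * Real.exp (-c) ≤ n * Real.exp (-(Real.log n + Real.log n)) := by
          gcongr
          linarith
      _ = 1 / n := by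
          rw [Real.exp_neg, Real.exp_add, Real.exp_log hn']
          field_simp
  have hall : ∀ S : Finset (Sym2 (Fin n)), ¬ Typical D y m S →
      (∃ t : Finset (Fin n), t.card = 4 ∧ pairs t ⊆ S) ∨
      (n ≤ 16 * (triangles S).card) ∨
      (∃ v, (Finset.univ.filter ((graph S).Adj v)).card < D + 3 * y + 1) ∨
      (∃ v, ∃ M ∈ packings S, v ∉ M.biUnion id ∧
        y ≤ (M.filter fun t => ∃ u ∈ t, s(v, u) ∈ S).card) ∨
      (∃ A B : Finset (Fin n), Disjoint A B ∧ A.card = m ∧ B.card = m ∧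
        ∀ a ∈ A, ∀ b ∈ B, s(a, b) ∉ S) ∨
      (∃ Z : Finset (Fin n), Z.Nonempty ∧ Z.card < 2 * m ∧
        Z.card * D ≤ 4 * (pairs Z ∩ S).card) := by
    intro S hS
    by_contra h
    simp only [not_or, not_exists, not_and, not_le, not_lt, not_forall, not_not] at h
    obtain ⟨a1, a2, a3, a4, a5, a6⟩ := h
    refine hS ⟨a1, a2, a3, a4, fun A B hAB hA hB => ?_, a6⟩
    obtain ⟨a, ha, b, hb, h⟩ := a5 A B hAB hA hB
    exact ⟨a, ha, b, hb, h⟩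
  have b1 := prob_exists_four_clique_le (n := n) h0 h1
  have b2 := prob_many_triangles_le h0 h1 hn
  have b3 := prob_exists_degree_lt_le h0 h1 hn (D + 3 * y + 1)
  have b4 : _ ≤ (n : ℝ) * Real.exp (-y) := prob_exists_packing_degree_le h0 h1 (n := n) (y := y) (by
    refine le_trans ?_ hy
    have h3 : (n : ℝ) ^ 3 * q ^ 4 = n * q * (n ^ 2 * q ^ 3) := by ring
    rw [h3]
    have h4 : n * q * (n ^ 2 * q ^ 3) ≤ n * q * (1 / 300) := by gcongr
    calc Real.exp 2 * (n * q * (n ^ 2 * q ^ 3)) ≤ 7.5 * (n * q * (1 / 300)) := by gcongr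
      _ ≤ n * q / 32 := by linarith [mul_nonneg hn'.le h0])
  have b5 := prob_exists_not_joined_le (n := n) h0 h1 m
  have b6 : _ ≤ Real.exp (1 / n) - 1 := prob_exists_dense_le (n := n) (m := m) (D := D) h0 h1 hn (by
    calc 4 * Real.exp 2 * (m * q) ≤ 4 * 7.5 * (3 * Real.log n + 1) := by gcongr
      _ ≤ D := by linarith) (by linarith)
  have c3 : n * (2 ^ (D + 3 * y + 1) * Real.exp (-(q / 2 * (n - 1)))) ≤ (2 : ℝ) / n := by
    have h2 : (2 : ℝ) ^ (D + 3 * y + 1) ≤ Real.exp (n * q / 4) := by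
      calc (2 : ℝ) ^ (D + 3 * y + 1) ≤ Real.exp 1 ^ (D + 3 * y + 1) := by
            refine pow_le_pow_left₀ (by norm_num) ?_ _
            linarith [Real.add_one_le_exp 1]
        _ = Real.exp (D + 3 * y + 1) := by
            rw [← Real.exp_nat_mul]
            push_cast
            ring_nf
        _ ≤ _ := Real.exp_le_exp.2 (by linarith)
    calc n * (2 ^ (D + 3 * y + 1) * Real.exp (-(q / 2 * (n - 1))))
        ≤ n * (Real.exp (n * q / 4) * Real.exp (-(q / 2 * (n - 1)))) := by gcongr
      _ = n * Real.exp (-(n * q / 4 - q / 2)) := by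
          rw [← Real.exp_add]
          ring_nf
      _ ≤ 1 / n := hexp _ (by linarith)
      _ ≤ 2 / n := by gcongr; norm_num
  have c4 : n * Real.exp (-y) ≤ 1 / n := hexp _ (by linarith)
  have c5 : (n : ℝ) ^ m * n ^ m * Real.exp (-(q * m * m)) ≤ 1 / n := by
    have h2 : (n : ℝ) ^ m = Real.exp (m * Real.log n) := by
      rw [Real.exp_nat_mul, Real.exp_log hn']
    have h3 : 1 / (n : ℝ) = Real.exp (-Real.log n) := by
      rw [Real.exp_neg, Real.exp_log hn', one_div]
    rw [h2, h3, ← Real.exp_add, ← Real.exp_add, Real.exp_le_exp]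
    nlinarith
  have hb := (prob_mono h0 h1 hall).trans ((prob_or_le h0 h1 _ _).trans (add_le_add b1
    ((prob_or_le h0 h1 _ _).trans (add_le_add b2 ((prob_or_le h0 h1 _ _).trans (add_le_add
    (b3.trans c3) ((prob_or_le h0 h1 _ _).trans (add_le_add (b4.trans c4)
    ((prob_or_le h0 h1 _ _).trans (add_le_add (b5.trans c5) b6))))))))))
  refine hb.trans (le_of_eq ?_)
  ring

/-! ### Transfer to the binomial random graph. -/

/-- The random set lives on all of `Sym2 (Fin n)`. Diagonal elements do not affect the graph and
contribute the factor q + (1 - q) = 1. -/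
lemma prob_graph_compl_eq (G : SimpleGraph (Fin n)) (q : ℝ) :
    prob (ι := Sym2 (Fin n)) q (fun S => (graph S)ᶜ = G) =
      (1 - q) ^ G.edgeSet.ncard * q ^ (n.choose 2 - G.edgeSet.ncard) := by
  have h : ∀ S : Finset (Sym2 (Fin n)), (graph S)ᶜ = G ↔
      (∀ e ∈ S, e.IsDiag ∨ e ∉ G.edgeSet) ∧ ∀ e ∉ S, e.IsDiag ∨ e ∈ G.edgeSet := by
    intro S
    constructor
    · rintro rfl
      constructor <;>
      · intro e
        induction e with
        | _ u v =>
          rw [SimpleGraph.mem_edgeSet, SimpleGraph.compl_adj, graph_adj, Sym2.mk_isDiag_iff]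
          tauto
    · rintro ⟨h1, h2⟩
      ext u v
      have h1 := h1 s(u, v)
      have h2 := h2 s(u, v)
      have h3 : G.Adj u v → u ≠ v := fun h => h.ne
      rw [SimpleGraph.mem_edgeSet, Sym2.mk_isDiag_iff] at h1 h2
      rw [SimpleGraph.compl_adj, graph_adj]
      tauto
  simp only [h]
  rw [prob_forall_and_forall]
  have h2 : ∀ e : Sym2 (Fin n), (q * (if e.IsDiag ∨ e ∉ G.edgeSet then 1 else 0) +
      (1 - q) * if e.IsDiag ∨ e ∈ G.edgeSet then 1 else 0) =
      (if e ∈ G.edgeFinset then 1 - q else 1) *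
      if e ∈ (⊤ : SimpleGraph (Fin n)).edgeFinset \ G.edgeFinset then q else 1 := by
    intro e
    have hd : e ∈ G.edgeSet → ¬ e.IsDiag := fun he => G.not_isDiag_of_mem_edgeSet he
    have ht : e ∈ (⊤ : SimpleGraph (Fin n)).edgeSet ↔ ¬ e.IsDiag := by
      rw [SimpleGraph.edgeSet_top]
      rfl
    simp only [Finset.mem_sdiff, SimpleGraph.mem_edgeFinset, ht]
    by_cases h1 : e ∈ G.edgeSet
    · simp [h1, hd h1]
    · by_cases h2 : e.IsDiag <;> simp [h1, h2]
  have h3 := Finset.prod_congr (rfl : (Finset.univ : Finset (Sym2 (Fin n))) = _) fun e _ => h2 e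
  convert h3 using 1
  · refine Finset.prod_congr rfl fun e _ => ?_
    congr!
  rw [Finset.prod_mul_distrib, Finset.prod_ite_mem,
    Finset.prod_ite_mem, Finset.univ_inter, Finset.univ_inter, Finset.prod_const,
    Finset.prod_const, Finset.card_sdiff_of_subset (SimpleGraph.edgeFinset_mono le_top),
    SimpleGraph.card_edgeFinset_top_eq_card_choose_two, Fintype.card_fin,
    Set.ncard_eq_toFinset_card']
  rfl

/-- The chromatic number of `G(n, 1 - q)` in terms of a random set of non-edges. -/
lemma chromaticProb_symm_eq (n : ℕ) (q : I) (A : Set ℝ) :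
    chromaticProb n (unitInterval.symm q) A = prob (ι := Sym2 (Fin n)) (q : ℝ)
      (fun S => (((graph S)ᶜ.chromaticNumber.toNat : ℕ) : ℝ) ∈ A) := by
  have h1 : ∀ G : SimpleGraph (Fin n),
      (SimpleGraph.binomialRandom (Fin n) (unitInterval.symm q)).real {G} =
        prob (ι := Sym2 (Fin n)) (q : ℝ) (fun S => (graph S)ᶜ = G) := by
    intro G
    rw [prob_graph_compl_eq, measureReal_def, SimpleGraph.binomialRandom_singleton]
    simp
  let P : Finset (SimpleGraph (Fin n)) :=
    Finset.univ.filter fun G => ((G.chromaticNumber.toNat : ℕ) : ℝ) ∈ A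
  have h2 : {G : SimpleGraph (Fin n) | ((G.chromaticNumber.toNat : ℕ) : ℝ) ∈ A} = ↑P := by
    ext G
    simp [P]
  have : MeasurableSingletonClass (SimpleGraph (Fin n)) := by
    refine ⟨fun G => ?_⟩
    have : ({G} : Set (SimpleGraph (Fin n))) = SimpleGraph.edgeSet ⁻¹' {G.edgeSet} := by
      ext H
      simp
    rw [this]
    exact SimpleGraph.measurable_edgeSet (measurableSet_singleton _)
  rw [chromaticProb, h2, ← sum_measureReal_singleton, Finset.sum_congr rfl fun G _ => h1 G]
  simp only [prob]
  rw [← expect_sum]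
  congr 1
  funext S
  rw [Finset.sum_ite_eq]
  simp [P]

end

/-! ### Assembling the bounds. -/

/-- The chromatic number is not concentrated on a short interval, for every `n` and `q` in the
sparse range. -/
lemma chromaticProb_Icc_le {n : ℕ} (q : I) (hl : 1 ≤ Real.log n)
    (hd : 2000 * Real.log n ≤ n * q) (hx : n ^ 2 * (q : ℝ) ^ 3 ≤ (1 / 300 : ℝ)) {a b : ℝ}
    (hab : a ≤ b) (hb : b - a ≤ 1 / 100 * (n : ℝ) ^ (3 / 2 : ℝ) * (q : ℝ) ^ (3 / 2 : ℝ)) :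
    chromaticProb n (unitInterval.symm q) (Set.Icc a b) ≤ 1 - 1 / 2 := by
  obtain ⟨q, h0, h1⟩ := q
  rw [chromaticProb_symm_eq]
  dsimp only at hd hx hb ⊢
  have hn' : (0 : ℝ) < n := by
    rcases Nat.eq_zero_or_pos n with rfl | h
    · norm_num at hl
    · exact_mod_cast h
  have hd2 : 2000 ≤ n * q := by linarith
  have hq : 0 < q := by
    by_contra h
    have : n * q ≤ 0 := mul_nonpos_of_nonneg_of_nonpos hn'.le (not_lt.1 h)
    linarith
  have hn2 : (2000 : ℝ) ≤ n := hd2.trans (mul_le_of_le_one_right hn'.le h1)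
  have hn3 : 2000 ≤ n := by exact_mod_cast hn2
  set l : ℝ := n.choose 3 * q ^ 3 with hldef
  set r : ℝ := (n : ℝ) ^ (3 / 2 : ℝ) * q ^ (3 / 2 : ℝ) with hr
  -- From n ≤ 2χ + ν ≤ n + 1 and a ≤ χ ≤ b, ν lies in [n - 2b, n - 2a + 1], which has this length.
  set L : ℝ := 2 * (b - a) + 1 with hL
  have hr0 : 0 ≤ r := by positivity
  have hr2 : r ^ 2 = (n * q) ^ 3 := by
    rw [hr, ← Real.mul_rpow hn'.le h0, ← Real.rpow_natCast, ← Real.rpow_mul (by positivity),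
      ← Real.rpow_natCast]
    norm_num
  have hr3 : 2000 ≤ r := by
    refine (sq_le_sq₀ (by norm_num) hr0).1 ?_
    rw [hr2]
    linarith [pow_le_pow_left₀ (by norm_num) hd2 3]
  have hl1 : r ^ 2 / 16 ≤ l := by
    have h6 : (n.choose 3 : ℝ) = n * (n - 1) * (n - 2) / 6 := by
      have h := Nat.add_one_mul_choose_eq (n - 1) 2
      rw [Nat.sub_add_cancel (by omega)] at h
      have h' : (n : ℝ) * ((n - 1 : ℕ).choose 2 : ℕ) = n.choose 3 * 3 := by exact_mod_cast h
      rw [Nat.cast_choose_two, Nat.cast_sub (by omega), Nat.cast_one] at h'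
      linarith
    rw [hr2, hldef, h6, mul_pow]
    have : (n : ℝ) ^ 3 / 16 ≤ n * (n - 1) * (n - 2) / 6 := by nlinarith
    have := mul_le_mul_of_nonneg_right this (by positivity : 0 ≤ q ^ 3)
    linarith
  have hl2 : 9 * l / n ≤ 9 * (n ^ 2 * q ^ 3) := by
    rw [div_le_iff₀ hn', hldef]
    have h3 : (n.choose 3 : ℝ) ≤ n ^ 3 := by exact_mod_cast Nat.choose_le_pow n 3
    have := mul_le_mul_of_nonneg_right h3 (by positivity : 0 ≤ q ^ 3)
    linarith
  set s : ℝ := √l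
  have hl0 : 0 ≤ l := by positivity
  have hs2 : s * s = l := Real.mul_self_sqrt hl0
  have hs : r / 4 ≤ s := Real.le_sqrt_of_sq_le (by linarith)
  have hs0 : 0 < s := by linarith
  have hvar : √(l * (1 + 3 * n * q ^ 2)) ≤ 2 * s := by
    rw [Real.sqrt_mul hl0, mul_comm]
    refine mul_le_mul_of_nonneg_right (Real.sqrt_le_iff.2 ⟨by norm_num, ?_⟩) hs0.le
    have : n * q ^ 2 ≤ (n : ℝ) ^ 2 * q ^ 3 := by
      have := mul_le_mul_of_nonneg_left (show 1 ≤ n * q by linarith)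
        (by positivity : 0 ≤ n * q ^ 2)
      linarith
    linarith
  have hpack : prob (ι := Sym2 (Fin n)) q (fun S => (n - 2 * b : ℝ) ≤ packingNumber S ∧
      (packingNumber S : ℝ) ≤ n - 2 * b + L) ≤ 9 * (n ^ 2 * q ^ 3) + 1 / 4 := by
    have h := mul_prob_packingNumber_le (n := n) h0 h1 (a := n - 2 * b) (L := L) (by linarith)
      (by omega)
    set p := prob (ι := Sym2 (Fin n)) q (fun S => (n - 2 * b : ℝ) ≤ packingNumber S ∧
      (packingNumber S : ℝ) ≤ n - 2 * b + L)
    -- Here c = 1/100 enters: L + 1 ≤ r/50 + 2 ≤ r/32 ≤ s/8, using r ≥ 2000.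
    have h2 : (L + 1) * √(l * (1 + 3 * n * q ^ 2)) ≤ l * (1 / 4) := by
      calc (L + 1) * √(l * (1 + 3 * n * q ^ 2)) ≤ (L + 1) * (2 * s) := by
            gcongr
        _ ≤ (s / 8) * (2 * s) := by
            refine mul_le_mul_of_nonneg_right ?_ (by positivity)
            linarith
        _ = l * (1 / 4) := by
            rw [← hs2]
            ring
    have hlpos : 0 < l := by
      rw [← hs2]
      positivity
    have h3 : l * p ≤ l * (9 * l / n + 1 / 4) := by
      rw [mul_add]
      linarith
    have := le_of_mul_le_mul_left h3 hlpos
    linarith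
  have htyp := prob_not_typical_le h1 hq hl hd hx
  have hm := sixteen_mul_ceil_le hq hl hd h1
  have hsplit : ∀ S : Finset (Sym2 (Fin n)),
      (((graph S)ᶜ.chromaticNumber.toNat : ℕ) : ℝ) ∈ Set.Icc a b →
      ¬ Typical ⌈n * q / 16⌉₊ ⌈n * q / 32⌉₊ ⌈3 * Real.log n / q⌉₊ S ∨
      ((n - 2 * b : ℝ) ≤ packingNumber S ∧ (packingNumber S : ℝ) ≤ n - 2 * b + L) := by
    rintro S ⟨ha, hb⟩
    by_cases hS : Typical ⌈n * q / 16⌉₊ ⌈n * q / 32⌉₊ ⌈3 * Real.log n / q⌉₊ S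
    · right
      have e1 : (n : ℝ) ≤ 2 * ((graph S)ᶜ.chromaticNumber.toNat : ℕ) + packingNumber S := by
        exact_mod_cast card_le_two_mul_chromaticNumber_add S hS.no_four
      have e2 : (2 * ((graph S)ᶜ.chromaticNumber.toNat : ℕ) + packingNumber S : ℝ) ≤ n + 1 := by
        exact_mod_cast hS.two_mul_chromaticNumber_add_le hm
      constructor <;> linarith
    · exact Or.inl hS
  refine (prob_mono h0 h1 hsplit).trans ((prob_or_le h0 h1 _ _).trans
    ((add_le_add htyp hpack).trans ?_))
  have hx0 : 0 ≤ (n : ℝ) ^ 2 * q ^ 3 := by positivity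
  have hinv : 1 / (n : ℝ) ≤ 1 / 2000 := one_div_le_one_div_of_le (by norm_num) hn2
  have h4 : 4 / (n : ℝ) = 4 * (1 / n) := by ring
  have hexp : Real.exp (1 / n) ≤ 1 + 2 * (1 / n) := by
    have := Real.exp_bound_div_one_sub_of_interval (x := 1 / (n : ℝ)) (by positivity) (by linarith)
    refine this.trans ?_
    rw [div_le_iff₀ (by linarith)]
    nlinarith [show 0 ≤ 1 / (n : ℝ) by positivity]
  -- With x = n²q³ ≤ 1/300 and n ≥ 2000, the total is at most x² + 25x + 6/n + 1/4 < 1/2.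
  rw [h4]
  nlinarith

end RandomSubset

/-- The constants `ε` and `c` are absolute: they are chosen before `q`. The edge probability is
`p = 1 - q`, written `unitInterval.symm (q n)`. Closed intervals suffice, since every bounded interval is contained
in a closed one of the same length. -/
theorem mainTheorem3 :
    ∃ ε : ℝ, 0 < ε ∧ ∃ c : ℝ, 0 < c ∧
      ∀ q : ℕ → I,
        SmoothDensity q →
        (fun n : ℕ => (n : ℝ)⁻¹ * Real.log (n : ℝ)) =o[atTop] (fun n : ℕ => (q n : ℝ)) →
        (fun n : ℕ => (q n : ℝ)) =o[atTop] (fun n : ℕ => (n : ℝ) ^ (-(2 / 3) : ℝ)) →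
        {n : ℕ | ∀ a b : ℝ, a ≤ b →
          b - a ≤ c * (n : ℝ) ^ (3 / 2 : ℝ) * (q n : ℝ) ^ (3 / 2 : ℝ) →
          chromaticProb n (unitInterval.symm (q n)) (Set.Icc a b) ≤ 1 - ε}.Infinite := by
  refine ⟨1 / 2, by norm_num, 1 / 100, by norm_num, fun q _ hlow hup => ?_⟩
  rw [← Nat.frequently_atTop_iff_infinite]
  refine Eventually.frequently ?_
  have hlog : ∀ᶠ n : ℕ in atTop, 1 ≤ Real.log n :=
    (Real.tendsto_log_atTop.comp tendsto_natCast_atTop_atTop).eventually_ge_atTop 1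
  -- The two asymptotic bounds become 2000 log n ≤ nq and, after cubing, n²q³ ≤ 1/1000 ≤ 1/300, both
  -- for all large n.
  filter_upwards [hlow.bound (show (0 : ℝ) < 1 / 2000 by norm_num),
    hup.bound (show (0 : ℝ) < 1 / 10 by norm_num), hlog, eventually_gt_atTop 0]
    with n h1 h2 h3 hn a b hab hb
  have hn' : (0 : ℝ) < n := by exact_mod_cast hn
  have hq : 0 ≤ (q n : ℝ) := (q n).2.1
  refine RandomSubset.chromaticProb_Icc_le (q n) h3 ?_ ?_ hab hb
  · rw [Real.norm_of_nonneg (by positivity), Real.norm_of_nonneg hq, inv_mul_le_iff₀ hn'] at h1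
    linarith
  · rw [Real.norm_of_nonneg hq, Real.norm_of_nonneg (by positivity)] at h2
    have h4 := pow_le_pow_left₀ hq h2 3
    have h5 : ((n : ℝ) ^ (-(2 / 3) : ℝ)) ^ 3 = ((n : ℝ) ^ 2)⁻¹ := by
      rw [← Real.rpow_natCast, ← Real.rpow_mul hn'.le, ← Real.rpow_natCast, ← Real.rpow_neg hn'.le]
      norm_num
    rw [mul_pow, h5] at h4
    have h6 := mul_le_mul_of_nonneg_left h4 (by positivity : 0 ≤ (n : ℝ) ^ 2)
    rw [mul_left_comm, mul_inv_cancel₀ (by positivity)] at h6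
    linarith
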